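/- For $n\ge 0$ let $\alpha_n$ be the number of permutations $w\in S_n$ that are 321-hexagon-avoiding, that is, that avoid all five patterns $[321]$, $[46718235]$, $[46781235]$, $[56718234]$, $[56781234]$ (so $\alpha_0=1$). Then the sequence satisfies $$\alpha_n=6\alpha_{n-1}-11\alpha_{n-2}+9\alpha_{n-3}-4\alpha_{n-4}-4\alpha_{n-5}+\alpha_{n-6}\qquad(n\ge 6).$$ The characteristic polynomial $x^6-6x^5+11x^4-9x^3+4x^2+4x-1$ of this recurrence has six roots, four of them real, $R_1,R_2,R_3,R_4$, and two of them complex conjugate, $R_5$ and $\overline{R_5}$, and there are $c_1,c_2,c_3,c_4\in\mathbb{R}$ and $c_5\in\mathbb{C}$ such that, for all $n\ge 0$, $$\alpha_n=c_1R_1^n+c_2R_2^n+c_3R_3^n+c_4R_4^n+c_5R_5^n+\overline{c_5R_5^n}.$$ Rounded to 5 digits after the decimal point (separately in the real and imaginary parts), the roots and coefficients are $$\begin{array}{lll} R_1\approx -0.49890, & c_1\approx -0.00328, & c_1R_1\approx 0.00164,\\ R_2\approx 0.21989, & c_2\approx 0.62652, & c_2R_2\approx 0.13776,\\ R_3\approx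 1.95627, & c_3\approx 0.29217, & c_3R_3\approx 0.57156,\\ R_4\approx 3.43526, & c_4\approx 0.07030, & c_4R_4\approx 0.24149,\\ R_5\approx 0.44375-1.07681i, & c_5\approx 0.00714+0.01914i, & c_5R_5\approx 0.02378+0.00080i, \end{array}$$ where the last column lists the coefficients of the same closed form written with the powers $R_i^{n-1}$ in place of $R_i^n$. In particular $\alpha_n\sim c_4R_4^n$ as $n\to\infty$, so $\alpha_n$ grows like $3.43526\ldots^{\,n}$. -/

import Mathlib

open scoped ComplexConjugate

namespace Hex321

/-- The permutation `w` of length `n` contains the pattern `v` of length `k`: some subsequence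
`w (f 0), …, w (f (k - 1))`, with `f` strictly increasing, has the same pairwise relations as
`v 0, …, v (k - 1)`. -/
def Contains {k n : ℕ} (v : Equiv.Perm (Fin k)) (w : Equiv.Perm (Fin n)) : Prop :=
  ∃ f : Fin k → Fin n, StrictMono f ∧ ∀ i j : Fin k, w (f i) < w (f j) ↔ v i < v j

/-- The pattern `[321]` in one-line notation. Here and below positions and values are counted
from `0`, so every entry is one less than in the usual notation. -/
noncomputable def pattern321 : Equiv.Perm (Fin 3) :=
  Equiv.ofBijective ![2, 1, 0] (by decide)

/-- The pattern `[46718235]`. -/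
noncomputable def octagon₁ : Equiv.Perm (Fin 8) :=
  Equiv.ofBijective ![3, 5, 6, 0, 7, 1, 2, 4] (by decide)

/-- The pattern `[46781235]`. -/
noncomputable def octagon₂ : Equiv.Perm (Fin 8) :=
  Equiv.ofBijective ![3, 5, 6, 7, 0, 1, 2, 4] (by decide)

/-- The pattern `[56718234]`. -/
noncomputable def octagon₃ : Equiv.Perm (Fin 8) :=
  Equiv.ofBijective ![4, 5, 6, 0, 7, 1, 2, 3] (by decide)

/-- The pattern `[56781234]`. -/
noncomputable def octagon₄ : Equiv.Perm (Fin 8) :=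
  Equiv.ofBijective ![4, 5, 6, 7, 0, 1, 2, 3] (by decide)

/-- The set of 321-hexagon-avoiding permutations of length `n`. -/
def hexAvoiding (n : ℕ) : Set (Equiv.Perm (Fin n)) :=
  {w | ¬ Contains pattern321 w ∧ ¬ Contains octagon₁ w ∧ ¬ Contains octagon₂ w ∧
    ¬ Contains octagon₃ w ∧ ¬ Contains octagon₄ w}

/-- The number of 321-hexagon-avoiding permutations of length `n`. -/
noncomputable def alpha (n : ℕ) : ℕ := (hexAvoiding n).ncard

/-- The recurrence
`u (n+6) = 6 u (n+5) - 11 u (n+4) + 9 u (n+3) - 4 u (n+2) - 4 u (n+1) + u n`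
(the coefficients are listed from `u n` to `u (n+5)`). -/
def hexRecurrence : LinearRecurrence ℂ where
  order := 6
  coeffs := ![1, -4, -4, 9, -11, 6]

/-- The real number `x`, rounded to five digits after the decimal point, is `d`. -/
def RoundsTo (x d : ℝ) : Prop := |x - d| < 0.000005

end Hex321

/-!
A 321-avoiding permutation `w` is increasing on its exceedances (`i < w i`) and on the other
positions, so it is determined by the set of exceedances and the set of their values. Recording both
letter by letter (`code`) turns `w` into a Motzkin path with two kinds of level steps at positive
height, whose height at a cutoff `c` is the number of `i < c` with `c ≤ w i`; all such paths occur
(`isPath_code`, `code_injOn`, `exists_code_eq`).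

The four octagonal patterns together say that `w` has two increasing subsequences of length four
with all but possibly two of the sixteen inversions between them (`hasOctagon_iff`). The
`x`-th exceedance crosses a cutoff `c` exactly if `x` lies between the numbers of exceedance values
and of exceedances below `c`. Replacing the two subsequences by consecutive exceedances and
consecutive other positions, an octagon becomes a condition on these numbers at two cutoffs
`d` and `d + 2` (`HasHexagon`, `Avoids321.hasOctagon_iff`); the numbers of the lower subsequence
satisfy the same inequalities, as the ranks of a crossing inversion add up to the cutoff.

Paths without hexagons stay below height `4`, and at height `3` they neither drop and rise at once
nor switch between the two kinds of level steps. A finite automaton recognizes this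
(`State.accepts_iff`), and its transfer matrix, after the two symmetric states are identified, has
the stated characteristic polynomial; this is the recurrence (`alpha_recurrence`).

The four real roots are found by the intermediate value theorem; the sum and the product of the
remaining two roots follow from the values of the polynomial at `0` and `1`, and their discriminant
is negative (`exists_roots`). The coefficient of a root `R` is `num R / den R`, where `den` is the
derivative of the characteristic polynomial, by Lagrange interpolation (`alpha_eq_sum`). The
decimals come from Lipschitz bounds for `num` and `den` at rational approximations (`near_coeff`),
and the asymptotics from the fact that the fourth root exceeds the others in absolute value.
-/

namespace Hex321

/-! ### Counting hits of a predicate below a cutoff -/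

/-- The number of indices `j < c` with `p j`; the cutoff `c` is a natural number, so that it may
also be `n` or larger. -/
def cnt {n : ℕ} (p : Fin n → Prop) [DecidablePred p] (c : ℕ) : ℕ :=
  (Finset.univ.filter fun j : Fin n => (j : ℕ) < c ∧ p j).card

section cnt
variable {n : ℕ} (p : Fin n → Prop) [DecidablePred p]

lemma cnt_mono : Monotone (cnt p) := fun _ _ hcd =>
  Finset.card_le_card fun _ hj => by
    simp only [Finset.mem_filter, Finset.mem_univ, true_and] at hj ⊢
    exact ⟨hj.1.trans_le hcd, hj.2⟩

lemma cnt_zero : cnt p 0 = 0 := by simp [cnt]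

lemma cnt_succ (i : Fin n) : cnt p (i + 1) = cnt p i + if p i then 1 else 0 := by
  unfold cnt
  split_ifs with h
  · rw [← Finset.card_insert_of_notMem (a := i) (by simp)]
    congr 1
    ext j
    simp only [Finset.mem_filter, Finset.mem_univ, true_and, Finset.mem_insert, Fin.ext_iff]
    constructor
    · rintro ⟨h1, h2⟩
      by_cases hj : (j : ℕ) = i
      · exact .inl hj
      · exact .inr ⟨by omega, h2⟩
    · rintro (h1 | h1)
      · exact ⟨by omega, by rwa [Fin.ext h1]⟩
      · exact ⟨by omega, h1.2⟩
  · rw [add_zero]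
    congr 1
    ext j
    simp only [Finset.mem_filter, Finset.mem_univ, true_and]
    refine and_congr_left fun hj => ?_
    have : (j : ℕ) ≠ i := fun e => h (by rwa [← Fin.ext e])
    omega

lemma cnt_of_le {c : ℕ} (h : n ≤ c) : cnt p c = cnt p n := by
  unfold cnt
  congr 1
  ext j
  simp [j.2.trans_le h]

lemma cnt_succ_le (c : ℕ) : cnt p (c + 1) ≤ cnt p c + 1 := by
  by_cases h : c < n
  · have := cnt_succ p ⟨c, h⟩
    simp only at this
    split_ifs at this <;> omega
  · rw [cnt_of_le p (by omega : n ≤ c + 1), cnt_of_le p (by omega : n ≤ c)]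
    omega

lemma cnt_add_le (c k : ℕ) : cnt p (c + k) ≤ cnt p c + k := by
  induction k with
  | zero => simp
  | succ k ih => have := cnt_succ_le p (c + k); rw [← add_assoc]; omega

lemma cnt_le_self (c : ℕ) : cnt p c ≤ c := by
  simpa [cnt_zero] using cnt_add_le p 0 c

variable {p} in
lemma cnt_lt {i : Fin n} (hi : p i) {c : ℕ} (h : (i : ℕ) < c) : cnt p i < cnt p c := by
  have h1 := cnt_succ p i
  rw [if_pos hi] at h1
  have := cnt_mono p (show (i : ℕ) + 1 ≤ c from h)
  omega

lemma cnt_not {c : ℕ} (h : c ≤ n) : cnt (fun i => ¬ p i) c + cnt p c = c := by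
  induction c with
  | zero => simp [cnt_zero]
  | succ c ih =>
    have h1 := cnt_succ p ⟨c, h⟩
    have h2 := cnt_succ (fun i => ¬ p i) ⟨c, h⟩
    simp only at h1 h2
    have := ih (by omega)
    split_ifs at h1 h2 <;> omega

variable {p} in
lemma cnt_inj {i j : Fin n} (hi : p i) (hj : p j) (h : cnt p i = cnt p j) : i = j := by
  rcases lt_trichotomy i j with hij | hij | hij
  · exact absurd h (cnt_lt hi hij).ne
  · exact hij
  · exact absurd h (cnt_lt hj hij).ne'

lemma lt_of_cnt_lt {c d : ℕ} (h : cnt p c < cnt p d) : c < d :=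
  (cnt_mono p).reflect_lt h

variable {p} in
lemma le_of_cnt_le {i : Fin n} (hi : p i) {c : ℕ} (h : cnt p c ≤ cnt p i) : c ≤ i := by
  by_contra! H
  exact absurd (cnt_lt hi H) (not_lt.mpr h)

/-- Every rank below the total count is attained. -/
lemma exists_cnt_eq {x : ℕ} (hx : x < cnt p n) : ∃ i, p i ∧ cnt p i = x := by
  suffices ∀ c ≤ n, x < cnt p c → ∃ i, p i ∧ cnt p i = x from this n le_rfl hx
  intro c
  induction c with
  | zero => simp [cnt_zero]
  | succ c ih =>
    intro hc hx
    by_cases h : x < cnt p c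
    · exact ih (by omega) h
    · have h1 := cnt_succ p ⟨c, hc⟩
      simp only at h1
      split_ifs at h1 with h2
      · exact ⟨⟨c, hc⟩, h2, by simp only; omega⟩
      · omega

/-- If some cutoff `t` has at least `x` hits and at most `y` misses before it, then at least `x`
of the first `x + y` indices are hits. -/
lemma le_cnt_add {t x y : ℕ} (hx : x ≤ cnt p t) (hy : t ≤ cnt p t + y) : x ≤ cnt p (x + y) := by
  rcases le_total t (x + y) with h | h
  · exact hx.trans (cnt_mono p h)
  · obtain ⟨k, rfl⟩ := Nat.exists_eq_add_of_le h
    have := cnt_add_le p (x + y) k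
    omega

/-- If some cutoff `t` has at most `x` hits and at least `y` misses before it, then at most `x`
of the first `x + y` indices are hits. -/
lemma cnt_add_le_of_le {t x y : ℕ} (hx : cnt p t ≤ x) (hy : cnt p t + y ≤ t) :
    cnt p (x + y) ≤ x := by
  rcases le_total (x + y) t with h | h
  · exact (cnt_mono p h).trans hx
  · obtain ⟨k, hk⟩ := Nat.exists_eq_add_of_le h
    have := cnt_add_le p t k
    rw [hk]
    omega

end cnt

lemma cnt_fin_succ {n : ℕ} (p : Fin (n + 1) → Prop) [DecidablePred p] (c : ℕ) :
    cnt p (c + 1) = (if p 0 then 1 else 0) + cnt (fun i => p i.succ) c := by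
  unfold cnt
  simp only [Finset.card_filter]
  rw [Fin.sum_univ_succ]
  congr 1
  · simp
  · simp

/-! ### The path of a 321-avoiding permutation -/

/-- The number of opening steps, those with first component `true`, before the cutoff `c`. -/
def opened {n : ℕ} (f : Fin n → Bool × Bool) (c : ℕ) : ℕ := cnt (fun i => (f i).1 = true) c

/-- The number of closing steps, those with second component `true`, before the cutoff `c`. -/
def closed {n : ℕ} (f : Fin n → Bool × Bool) (c : ℕ) : ℕ := cnt (fun i => (f i).2 = true) c

/-- The word `f` is a path that starts at height `h`, ends at height `0` and never closes more than
is open. A letter `(a, b)` raises the height if `a` is `true` and lowers it if `b` is `true`; when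
both are, the closing comes first, so that this needs positive height. -/
def IsPath {n : ℕ} (h : ℕ) (f : Fin n → Bool × Bool) : Prop :=
  (∀ i : Fin n, closed f (i + 1) ≤ h + opened f i) ∧ h + opened f n = closed f n

/-- The path starting at height `h` with word `f` has a hexagon. Let the openings be numbered from
`0`, with `h` openings in advance, and be closed in the same order, so that
`closed f c, …, h + opened f c - 1` are open at the cutoff `c`. In a hexagon, `x - 2, x - 1, x` are
open at a cutoff `d` and `x - 1, x, x + 1` are open at `d + 2`. -/
def HasHexagon {n : ℕ} (h : ℕ) (f : Fin n → Bool × Bool) : Prop :=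
  ∃ d x, closed f d + 2 ≤ x ∧ x + 1 ≤ h + opened f d ∧
    closed f (d + 2) + 1 ≤ x ∧ x + 2 ≤ h + opened f (d + 2)

/-- The word of a permutation `w`: at `i` it records whether the position `i` is an exceedance,
`i < w i`, and whether the value `i` is one, `w⁻¹ i < i`. -/
def code {n : ℕ} (w : Equiv.Perm (Fin n)) : Fin n → Bool × Bool :=
  fun i => (decide (i < w i), decide (w.symm i < i))

/-- `w` has no decreasing subsequence of length three. -/
def Avoids321 {n : ℕ} (w : Equiv.Perm (Fin n)) : Prop :=
  ∀ i j k, i < j → j < k → w j < w i → ¬ w k < w j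

section perm
variable {n : ℕ} {w : Equiv.Perm (Fin n)}

lemma opened_code (c : ℕ) : opened (code w) c = cnt (fun i => i < w i) c := by
  simp [opened, code]

lemma closed_code (c : ℕ) : closed (code w) c = cnt (fun i => w.symm i < i) c := by
  simp [closed, code]

/-- An exceedance is followed by a smaller value. -/
lemma exists_lt_apply_lt {j : Fin n} (h : j < w j) : ∃ k, j < k ∧ w k < w j := by
  by_contra! H
  have := Finset.card_le_card_of_injOn w.symm (s := Finset.Iio (w j)) (t := Finset.Iio j)
    (fun v hv => by
      simp only [Finset.coe_Iio, Set.mem_Iio] at hv ⊢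
      by_contra! hlt
      rcases hlt.eq_or_lt with e | hlt
      · subst e; simp at hv
      · have := H _ hlt
        simp only [Equiv.apply_symm_apply] at this
        exact absurd hv (not_lt.mpr this)) w.symm.injective.injOn
  simp only [Fin.card_Iio] at this
  exact absurd (Fin.lt_def.mp h) (not_lt.mpr this)

/-- A position that is not an exceedance but is followed by a smaller value is also preceded by a
larger one. -/
lemma exists_gt_apply_gt {i j : Fin n} (h : w i ≤ i) (hij : i < j) (hw : w j < w i) :
    ∃ k, k < i ∧ w i < w k := by
  by_contra! H
  have := Finset.card_le_card_of_injOn w (s := insert j (Finset.Iio i)) (t := Finset.Iio (w i))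
    (fun v hv => by
      simp only [Finset.coe_insert, Finset.coe_Iio, Set.mem_insert_iff, Set.mem_Iio] at hv ⊢
      rcases hv with rfl | hv
      · exact hw
      · exact lt_of_le_of_ne (H _ hv) (fun e => hv.ne (w.injective e))) w.injective.injOn
  rw [Finset.card_insert_of_notMem (by simpa using hij.le), Fin.card_Iio, Fin.card_Iio] at this
  have := Fin.le_def.mp h
  omega

lemma Avoids321.exc_of_lt (hw : Avoids321 w) {i j : Fin n} (hij : i < j) (h : w j < w i) :
    i < w i := by
  by_contra! H
  obtain ⟨k, hk, hk'⟩ := exists_gt_apply_gt H hij h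
  exact hw k i j hk hij hk' h

lemma Avoids321.not_exc_of_lt (hw : Avoids321 w) {i j : Fin n} (hij : i < j) (h : w j < w i) :
    ¬ j < w j := by
  intro H
  obtain ⟨k, hk, hk'⟩ := exists_lt_apply_lt H
  exact hw i j k hij hk h hk'

lemma Avoids321.apply_lt (hw : Avoids321 w) {i j : Fin n} (h : i < w i ↔ j < w j)
    (hij : i < j) : w i < w j := by
  by_contra! H
  have H := lt_of_le_of_ne H (fun e => hij.ne' (w.injective e))
  exact hw.not_exc_of_lt hij H (h.mp (hw.exc_of_lt hij H))

lemma cnt_symm {p : Fin n → Prop} [DecidablePred p]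
    (hp : ∀ i j, p i → p j → i < j → w i < w j) {k : Fin n} (hk : p k) :
    cnt (fun v => p (w.symm v)) (w k) = cnt p k := by
  unfold cnt
  symm
  refine Finset.card_equiv w fun i => ?_
  simp only [Finset.mem_filter, Finset.mem_univ, true_and, Equiv.symm_apply_apply, Fin.val_fin_lt]
  refine and_congr_left fun hi => ⟨hp i k hi hk, fun h => ?_⟩
  by_contra! H
  rcases H.eq_or_lt with rfl | H
  · exact h.false
  · exact h.asymm (hp k i hk hi H)

lemma Avoids321.closed_apply (hw : Avoids321 w) {k : Fin n} (hk : k < w k) :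
    closed (code w) (w k) = opened (code w) k := by
  rw [opened_code, closed_code,
    ← cnt_symm (w := w) (fun i j hi hj => hw.apply_lt (iff_of_true hi hj)) hk]
  simp

lemma Avoids321.cnt_not_apply (hw : Avoids321 w) {k : Fin n} (hk : ¬ k < w k) :
    cnt (fun v => ¬ w.symm v < v) (w k) = cnt (fun i => ¬ i < w i) k := by
  rw [← cnt_symm (w := w) (fun i j hi hj => hw.apply_lt (iff_of_false hi hj)) hk]
  simp

lemma isPath_code (w : Equiv.Perm (Fin n)) : IsPath 0 (code w) := by
  refine ⟨fun i => ?_, ?_⟩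
  · rw [opened_code, closed_code, zero_add]
    refine Finset.card_le_card_of_injOn w.symm (fun v hv => ?_) w.symm.injective.injOn
    simp only [Finset.coe_filter, Finset.mem_univ, true_and, Set.mem_ofPred_eq,
      Equiv.apply_symm_apply, Fin.lt_def] at hv ⊢
    omega
  · rw [opened_code, closed_code, zero_add]
    refine Finset.card_equiv w fun i => ?_
    simp

lemma code_injOn {w w' : Equiv.Perm (Fin n)} (hw : Avoids321 w) (hw' : Avoids321 w')
    (h : code w = code w') : w = w' := by
  have hexc : ∀ i, i < w i ↔ i < w' i := fun i => by simpa [code] using congrArg Prod.fst (congrFun h i)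
  have hval : ∀ i, w.symm i < i ↔ w'.symm i < i :=
    fun i => by simpa [code] using congrArg Prod.snd (congrFun h i)
  ext k : 1
  by_cases hk : k < w k
  · have h1 := hw.closed_apply hk
    have h2 := hw'.closed_apply ((hexc k).mp hk)
    rw [← h, ← h1, closed_code, closed_code] at h2
    refine cnt_inj (by simpa using hk) ?_ h2.symm
    rw [hval]
    simpa using (hexc k).mp hk
  · have hk' := fun H => hk ((hexc k).mpr H)
    have h1 := hw.cnt_not_apply hk
    have h2 := hw'.cnt_not_apply hk'
    simp only [← hval, ← hexc] at h2
    refine cnt_inj (p := fun i => ¬ w.symm i < i) (by simpa using hk) ?_ (h1.trans h2.symm)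
    rw [hval]
    simpa using hk'

/-- Every path is the word of the permutation that sends the openings, in order, to the closings,
and the other positions, in order, to the other values. -/
lemma exists_code_eq {f : Fin n → Bool × Bool} (hf : IsPath 0 f) :
    ∃ w, Avoids321 w ∧ code w = f := by
  obtain ⟨hle, hn⟩ := hf
  simp only [zero_add] at hle hn
  have key : ∀ k : Fin n, ∃ v : Fin n, ((f v).2 = true ↔ (f k).1 = true) ∧
      ((f k).1 = true → closed f v = opened f k) ∧
      (¬ (f k).1 = true → v + opened f k = k + closed f v) := by
    intro k
    have h1 := cnt_not (fun i => (f i).1 = true) k.2.le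
    have h2 := cnt_not (fun i => (f i).1 = true) le_rfl
    have h3 := cnt_not (fun i => (f i).2 = true) le_rfl
    simp only [opened, closed] at *
    by_cases hk : (f k).1 = true
    · obtain ⟨v, hv, hv'⟩ := exists_cnt_eq (fun i => (f i).2 = true)
        (x := cnt (fun i => (f i).1 = true) k)
        (by rw [← hn]; exact cnt_lt hk k.2)
      exact ⟨v, by simp [hv, hk], fun _ => hv', fun h => absurd hk h⟩
    · obtain ⟨v, hv, hv'⟩ := exists_cnt_eq (fun i => ¬ (f i).2 = true)
        (x := cnt (fun i => ¬ (f i).1 = true) k)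
        (by have := cnt_lt (p := fun i => ¬ (f i).1 = true) hk k.2; omega)
      have h4 := cnt_not (fun i => (f i).2 = true) v.2.le
      exact ⟨v, by simp [hv, hk], fun h => absurd h hk, fun _ => by omega⟩
  choose u hu1 hu2 hu3 using key
  have hinj : Function.Injective u := by
    intro i j hij
    have h1 := hu1 i
    have h2 := hu1 j
    rw [hij, h2] at h1
    by_cases hi : (f i).1 = true
    · have hj := h1.mpr hi
      have e1 := hu2 i hi
      have e2 := hu2 j hj
      rw [hij] at e1
      exact cnt_inj (p := fun i => (f i).1 = true) hi hj (e1.symm.trans e2)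
    · have hj := fun H => hi (h1.mp H)
      have e1 := hu3 i hi
      have e2 := hu3 j hj
      rw [hij] at e1
      have h3 := cnt_not (fun i => (f i).1 = true) i.2.le
      have h4 := cnt_not (fun i => (f i).1 = true) j.2.le
      refine cnt_inj (p := fun i => ¬ (f i).1 = true) hi hj ?_
      simp only [opened] at *
      omega
  have hexc : ∀ k, k < u k ↔ (f k).1 = true := by
    intro k
    constructor
    · intro h
      by_contra hk
      have e := hu3 k hk
      have h1 := cnt_not (fun i => (f i).2 = true) (show (k : ℕ) + 1 ≤ n from k.2)
      have h2 := cnt_not (fun i => (f i).2 = true) (u k).2.le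
      have h3 := cnt_mono (fun i => ¬ (f i).2 = true) (show (k : ℕ) + 1 ≤ u k from h)
      have h4 := hle k
      simp only [opened, closed] at *
      omega
    · intro hk
      by_contra! h
      have e := hu2 k hk
      have h1 := cnt_lt (p := fun i => (f i).2 = true) ((hu1 k).mpr hk)
        (show (u k : ℕ) < k + 1 from Nat.lt_succ_of_le h)
      have h4 := hle k
      simp only [opened, closed] at *
      omega
  have hmono : ∀ i j, ((f i).1 = true ↔ (f j).1 = true) → i < j → u i < u j := by
    intro i j hij h
    by_contra! H
    by_cases hi : (f i).1 = true
    · have := cnt_lt (p := fun i => (f i).1 = true) hi h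
      have := cnt_mono (fun i => (f i).2 = true) H
      have := hu2 i hi
      have := hu2 j (hij.mp hi)
      simp only [opened, closed] at *
      omega
    · have := cnt_lt (p := fun i => ¬ (f i).1 = true) hi h
      have := cnt_mono (fun i => ¬ (f i).2 = true) H
      have := hu3 i hi
      have := hu3 j (fun h => hi (hij.mpr h))
      have h1 := cnt_not (fun i => (f i).1 = true) i.2.le
      have h2 := cnt_not (fun i => (f i).1 = true) j.2.le
      have h3 := cnt_not (fun i => (f i).2 = true) (u i).2.le
      have h4 := cnt_not (fun i => (f i).2 = true) (u j).2.le
      simp only [opened, closed] at *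
      omega
  set w := Equiv.ofBijective u (Finite.injective_iff_bijective.mp hinj) with hwdef
  have hw : ∀ i, w i = u i := fun i => rfl
  refine ⟨w, fun i j k hij hjk h1 h2 => ?_, ?_⟩
  · -- two of three positions agree on being openings
    rw [hw, hw] at h1 h2
    by_cases e : (f i).1 = true ↔ (f j).1 = true
    · exact h1.asymm (hmono i j e hij)
    · by_cases e' : (f j).1 = true ↔ (f k).1 = true
      · exact h2.asymm (hmono j k e' hjk)
      · exact (h2.trans h1).asymm (hmono i k (by tauto) (hij.trans hjk))
  · funext v
    obtain ⟨k, rfl⟩ := w.surjective v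
    refine Prod.ext (Bool.eq_iff_iff.mpr ?_) (Bool.eq_iff_iff.mpr ?_)
    · simpa [code] using show w k < w (w k) ↔ _ from hexc (w k)
    · simpa [code] using show k < w k ↔ (f (w k)).2 = true from (hexc k).trans (hu1 k).symm

end perm

/-! ### The octagonal patterns as hexagons of the path -/

section patterns
variable {n : ℕ} {w : Equiv.Perm (Fin n)}

/-- Two increasing subsequences of `w`, at positions `a` and `b`, that have all the inversions
between them that the four octagonal patterns share: every `a i` with every `b j`, except possibly
`a 0` with `b 3` and `a 3` with `b 0`. -/
def HasOctagon (w : Equiv.Perm (Fin n)) : Prop :=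
  ∃ a b : Fin 4 → Fin n, StrictMono a ∧ StrictMono b ∧ StrictMono (w ∘ a) ∧ StrictMono (w ∘ b) ∧
    a 2 < b 0 ∧ a 3 < b 1 ∧ w (b 2) < w (a 0) ∧ w (b 3) < w (a 1)

/-- To contain `v`, it suffices that the entries of `w` at positions `f`, listed in the order of the
values of `v`, increase. -/
lemma contains_of_strictMono {k : ℕ} {v : Equiv.Perm (Fin k)} {f : Fin k → Fin n}
    (hf : StrictMono f) (u : Fin k → Fin k) (hu : ∀ i, v (u i) = i)
    (h : StrictMono fun i => w (f (u i))) : Contains v w := by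
  refine ⟨f, hf, fun i j => ?_⟩
  have hi : u (v i) = i := v.injective (hu _)
  have hj : u (v j) = j := v.injective (hu _)
  rw [← h.lt_iff_lt, hi, hj]

lemma not_contains_pattern321 : ¬ Contains pattern321 w ↔ Avoids321 w := by
  constructor
  · intro h i j k hij hjk h1 h2
    refine h (contains_of_strictMono (f := ![i, j, k]) ?_ ![2, 1, 0] ?_ ?_)
    · simp [Fin.strictMono_iff_lt_succ, Fin.forall_fin_succ, hij, hjk]
    · simp [Fin.forall_fin_succ, pattern321]
    · simp [Fin.strictMono_iff_lt_succ, Fin.forall_fin_succ, h1, h2]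
  · rintro h ⟨f, hf, hv⟩
    refine h (f 0) (f 1) (f 2) (hf (by decide)) (hf (by decide)) ?_ ?_
    · rw [hv]; simp [pattern321]
    · rw [hv]; simp [pattern321]

lemma hasOctagon_iff : HasOctagon w ↔ Contains octagon₁ w ∨ Contains octagon₂ w ∨
    Contains octagon₃ w ∨ Contains octagon₄ w := by
  constructor
  · rintro ⟨a, b, ha, hb, hwa, hwb, h20, h31, hw20, hw31⟩
    have a01 := ha (show (0 : Fin 4) < 1 by decide)
    have a12 := ha (show (1 : Fin 4) < 2 by decide)
    have a23 := ha (show (2 : Fin 4) < 3 by decide)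
    have b01 := hb (show (0 : Fin 4) < 1 by decide)
    have b12 := hb (show (1 : Fin 4) < 2 by decide)
    have b23 := hb (show (2 : Fin 4) < 3 by decide)
    have wa01 := hwa (show (0 : Fin 4) < 1 by decide)
    have wa12 := hwa (show (1 : Fin 4) < 2 by decide)
    have wa23 := hwa (show (2 : Fin 4) < 3 by decide)
    have wb01 := hwb (show (0 : Fin 4) < 1 by decide)
    have wb12 := hwb (show (1 : Fin 4) < 2 by decide)
    have wb23 := hwb (show (2 : Fin 4) < 3 by decide)
    simp only [Function.comp_apply] at wa01 wa12 wa23 wb01 wb12 wb23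
    have ne1 : b 0 ≠ a 3 := fun e => by rw [e] at wb01; exact absurd (wa12.trans wa23) (by order)
    have ne2 : w (a 0) ≠ w (b 3) := fun e => by have := w.injective e; order
    rcases ne1.lt_or_gt with h | h <;> rcases ne2.lt_or_gt with h' | h'
    · refine .inl (contains_of_strictMono (f := ![a 0, a 1, a 2, b 0, a 3, b 1, b 2, b 3]) ?_
        ![3, 5, 6, 0, 7, 1, 2, 4] ?_ ?_)
      · simp [Fin.strictMono_iff_lt_succ, Fin.forall_fin_succ, *]
      · simp [Fin.forall_fin_succ, octagon₁]
      · simp [Fin.strictMono_iff_lt_succ, Fin.forall_fin_succ, *]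
    · refine .inr (.inr (.inl (contains_of_strictMono (f := ![a 0, a 1, a 2, b 0, a 3, b 1, b 2, b 3]) ?_
        ![3, 5, 6, 7, 0, 1, 2, 4] ?_ ?_)))
      · simp [Fin.strictMono_iff_lt_succ, Fin.forall_fin_succ, *]
      · simp [Fin.forall_fin_succ, octagon₃]
      · simp [Fin.strictMono_iff_lt_succ, Fin.forall_fin_succ, *]
    · refine .inr (.inl (contains_of_strictMono (f := ![a 0, a 1, a 2, a 3, b 0, b 1, b 2, b 3]) ?_
        ![4, 5, 6, 0, 7, 1, 2, 3] ?_ ?_))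
      · simp [Fin.strictMono_iff_lt_succ, Fin.forall_fin_succ, *]
      · simp [Fin.forall_fin_succ, octagon₂]
      · simp [Fin.strictMono_iff_lt_succ, Fin.forall_fin_succ, *]
    · refine .inr (.inr (.inr (contains_of_strictMono (f := ![a 0, a 1, a 2, a 3, b 0, b 1, b 2, b 3]) ?_
        ![4, 5, 6, 7, 0, 1, 2, 3] ?_ ?_)))
      · simp [Fin.strictMono_iff_lt_succ, Fin.forall_fin_succ, *]
      · simp [Fin.forall_fin_succ, octagon₄]
      · simp [Fin.strictMono_iff_lt_succ, Fin.forall_fin_succ, *]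
  · rintro (⟨f, hf, hv⟩ | ⟨f, hf, hv⟩ | ⟨f, hf, hv⟩ | ⟨f, hf, hv⟩)
    · refine ⟨f ∘ ![0, 1, 2, 4], f ∘ ![3, 5, 6, 7], hf.comp (by decide), hf.comp (by decide), ?_⟩
      simp [Fin.strictMono_iff_lt_succ, Fin.forall_fin_succ, hv, hf.lt_iff_lt, octagon₁]
    · refine ⟨f ∘ ![0, 1, 2, 3], f ∘ ![4, 5, 6, 7], hf.comp (by decide), hf.comp (by decide), ?_⟩
      simp [Fin.strictMono_iff_lt_succ, Fin.forall_fin_succ, hv, hf.lt_iff_lt, octagon₂]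
    · refine ⟨f ∘ ![0, 1, 2, 4], f ∘ ![3, 5, 6, 7], hf.comp (by decide), hf.comp (by decide), ?_⟩
      simp [Fin.strictMono_iff_lt_succ, Fin.forall_fin_succ, hv, hf.lt_iff_lt, octagon₃]
    · refine ⟨f ∘ ![0, 1, 2, 3], f ∘ ![4, 5, 6, 7], hf.comp (by decide), hf.comp (by decide), ?_⟩
      simp [Fin.strictMono_iff_lt_succ, Fin.forall_fin_succ, hv, hf.lt_iff_lt, octagon₄]

/-- In a permutation without decreasing triples, an octagon is a hexagon of the path. -/
lemma Avoids321.hasOctagon_iff (hw : Avoids321 w) : HasOctagon w ↔ HasHexagon 0 (code w) := by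
  constructor
  · rintro ⟨a, b, ha, hb, hwa, hwb, h20, h31, hw20, hw31⟩
    have a01 := ha (show (0 : Fin 4) < 1 by decide)
    have a12 := ha (show (1 : Fin 4) < 2 by decide)
    have a23 := ha (show (2 : Fin 4) < 3 by decide)
    have b01 := hb (show (0 : Fin 4) < 1 by decide)
    have b12 := hb (show (1 : Fin 4) < 2 by decide)
    have b23 := hb (show (2 : Fin 4) < 3 by decide)
    have wa01 := hwa (show (0 : Fin 4) < 1 by decide)
    have wa12 := hwa (show (1 : Fin 4) < 2 by decide)
    have wa23 := hwa (show (2 : Fin 4) < 3 by decide)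
    have wb01 := hwb (show (0 : Fin 4) < 1 by decide)
    have wb12 := hwb (show (1 : Fin 4) < 2 by decide)
    have wb23 := hwb (show (2 : Fin 4) < 3 by decide)
    simp only [Function.comp_apply] at wa01 wa12 wa23 wb01 wb12 wb23
    have ea0 : a 0 < w (a 0) := hw.exc_of_lt (j := b 2) (by order) (by order)
    have ea1 : a 1 < w (a 1) := hw.exc_of_lt (j := b 2) (by order) (by order)
    have ea2 : a 2 < w (a 2) := hw.exc_of_lt (j := b 2) (by order) (by order)
    have ea3 : a 3 < w (a 3) := hw.exc_of_lt (j := b 2) (by order) (by order)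
    have eb0 : ¬ b 0 < w (b 0) := hw.not_exc_of_lt (i := a 1) (by order) (by order)
    have eb1 : ¬ b 1 < w (b 1) := hw.not_exc_of_lt (i := a 1) (by order) (by order)
    have eb2 : ¬ b 2 < w (b 2) := hw.not_exc_of_lt (i := a 1) (by order) (by order)
    have eb3 : ¬ b 3 < w (b 3) := hw.not_exc_of_lt (i := a 1) (by order) (by order)
    have ra0 := hw.closed_apply ea0
    have ra1 := hw.closed_apply ea1
    have rb2 := hw.cnt_not_apply eb2
    have rb3 := hw.cnt_not_apply eb3
    rw [opened_code, closed_code] at ra0 ra1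
    have ha01 := cnt_lt (p := fun i => i < w i) ea0 a01
    have ha12 := cnt_lt (p := fun i => i < w i) ea1 a12
    have ha20 := cnt_lt (p := fun i => i < w i) ea2 h20
    have ha23 := cnt_lt (p := fun i => i < w i) ea2 a23
    have ha31 := cnt_lt (p := fun i => i < w i) ea3 h31
    have hb01 := cnt_lt (p := fun i => ¬ i < w i) eb0 b01
    have hb12 := cnt_lt (p := fun i => ¬ i < w i) eb1 b12
    have hb23 := cnt_lt (p := fun i => ¬ i < w i) eb2 b23
    have hv20 := cnt_lt (p := fun i => ¬ w.symm i < i) (by simpa using eb2) hw20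
    have hv31 := cnt_lt (p := fun i => ¬ w.symm i < i) (by simpa using eb3) hw31
    have n0 := cnt_not (fun i => i < w i) (b 0).2.le
    have n1 := cnt_not (fun i => i < w i) (b 1).2.le
    have m0 := cnt_not (fun i => w.symm i < i) (w (a 0)).2.le
    have m1 := cnt_not (fun i => w.symm i < i) (w (a 1)).2.le
    -- replace `a 0, a 1, a 3` by the neighbours of `a 2` among the exceedances, and
    -- `b 0, b 2, b 3` by those of `b 1` among the other positions; only the ranks are needed
    generalize hx : cnt (fun i => i < w i) (a 2) = x at *
    generalize hy : cnt (fun i => ¬ i < w i) (b 1) = y at *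
    refine ⟨x + y, x, ?_, ?_, ?_, ?_⟩ <;> simp only [opened_code, closed_code, zero_add]
    · have := cnt_add_le_of_le (fun i => w.symm i < i) (t := w (a 0)) (x := x - 2) (y := y + 2)
        (by omega) (by omega)
      rw [show x - 2 + (y + 2) = x + y by omega] at this
      omega
    · have := le_cnt_add (fun i => i < w i) (t := b 0) (x := x + 1) (y := y - 1)
        (by omega) (by omega)
      rwa [show x + 1 + (y - 1) = x + y by omega] at this
    · have := cnt_add_le_of_le (fun i => w.symm i < i) (t := w (a 1)) (x := x - 1) (y := y + 3)
        (by omega) (by omega)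
      rw [show x - 1 + (y + 3) = x + y + 2 by omega] at this
      omega
    · have := le_cnt_add (fun i => i < w i) (t := b 1) (x := x + 2) (y := y)
        (by omega) (by omega)
      rwa [show x + 2 + y = x + y + 2 by omega] at this
  · rintro ⟨d, x, h1, h2, h3, h4⟩
    have hn := (isPath_code w).2
    simp only [opened_code, closed_code, zero_add] at h1 h2 h3 h4 hn
    have hd : d + 2 ≤ n := by
      by_contra! H
      rw [cnt_of_le _ H.le] at h3 h4
      omega
    have hE := cnt_mono (fun i => i < w i) hd
    have hA := cnt_mono (fun i => ¬ w.symm i < i) hd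
    have n0 := cnt_not (fun i => i < w i) (show d ≤ n by omega)
    have n1 := cnt_not (fun i => i < w i) hd
    have n2 := cnt_not (fun i => i < w i) (le_refl n)
    have m0 := cnt_not (fun i => w.symm i < i) (show d ≤ n by omega)
    have m1 := cnt_not (fun i => w.symm i < i) hd
    have m2 := cnt_not (fun i => w.symm i < i) (le_refl n)
    have hxd := cnt_le_self (fun i => i < w i) d
    choose a ha ra using fun i : Fin 4 =>
      exists_cnt_eq (fun i => i < w i) (x := x - 2 + i) (by omega)
    choose b hb rb using fun j : Fin 4 =>
      exists_cnt_eq (fun i => ¬ i < w i) (x := d - x - 1 + j) (by omega)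
    have ra' := fun i => hw.closed_apply (ha i)
    have rb' := fun j => hw.cnt_not_apply (hb j)
    simp only [opened_code, closed_code, ra, rb] at ra' rb'
    refine ⟨a, b, ?_, ?_, ?_, ?_, ?_, ?_, ?_, ?_⟩
    · exact fun i j hij => lt_of_cnt_lt (fun i => i < w i) (by rw [ra, ra]; omega)
    · exact fun i j hij => lt_of_cnt_lt (fun i => ¬ i < w i) (by rw [rb, rb]; omega)
    · exact fun i j hij => lt_of_cnt_lt (fun i => w.symm i < i)
        (by simp only [Function.comp_apply, ra']; omega)
    · exact fun i j hij => lt_of_cnt_lt (fun i => ¬ w.symm i < i)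
        (by simp only [Function.comp_apply, rb']; omega)
    · exact (lt_of_cnt_lt (fun i => i < w i) (by rw [ra]; omega)).trans_le
        (le_of_cnt_le (p := fun i => ¬ i < w i) (hb 0) (c := d) (by rw [rb]; omega))
    · exact (lt_of_cnt_lt (fun i => i < w i) (by rw [ra]; omega)).trans_le
        (le_of_cnt_le (p := fun i => ¬ i < w i) (hb 1) (c := d + 2) (by rw [rb]; omega))
    · exact (lt_of_cnt_lt (fun i => ¬ w.symm i < i) (by rw [rb']; omega)).trans_le
        (le_of_cnt_le (p := fun i => w.symm i < i) (by simpa using ha 0) (c := d)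
          (by rw [ra']; omega))
    · exact (lt_of_cnt_lt (fun i => ¬ w.symm i < i) (by rw [rb']; omega)).trans_le
        (le_of_cnt_le (p := fun i => w.symm i < i) (by simpa using ha 1) (c := d + 2)
          (by rw [ra']; omega))

lemma mem_hexAvoiding : w ∈ hexAvoiding n ↔ Avoids321 w ∧ ¬ HasHexagon 0 (code w) := by
  rw [hexAvoiding, Set.mem_ofPred_eq, not_contains_pattern321]
  refine and_congr_right fun hw => ?_
  rw [← hw.hasOctagon_iff, Hex321.hasOctagon_iff]
  tauto

lemma alpha_eq_ncard (n : ℕ) :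
    alpha n = {f : Fin n → Bool × Bool | IsPath 0 f ∧ ¬ HasHexagon 0 f}.ncard := by
  refine Set.ncard_congr (fun w _ => code w) (fun w hw => ?_) (fun w w' hw hw' h => ?_)
    (fun f hf => ?_)
  · exact ⟨isPath_code w, (mem_hexAvoiding.mp hw).2⟩
  · exact code_injOn (mem_hexAvoiding.mp hw).1 (mem_hexAvoiding.mp hw').1 h
  · obtain ⟨w, hw, rfl⟩ := exists_code_eq hf.1
    exact ⟨w, mem_hexAvoiding.mpr ⟨hw, hf.2⟩, rfl⟩

end patterns

/-! ### The automaton and the recurrence -/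

section cons
variable {n : ℕ} (f : Fin (n + 1) → Bool × Bool)

lemma opened_cons (c : ℕ) :
    opened f (c + 1) = (f 0).1.toNat + opened (Fin.tail f) c := by
  rw [opened, cnt_fin_succ]
  cases (f 0).1 <;> simp [opened, Fin.tail] <;> rfl

lemma closed_cons (c : ℕ) :
    closed f (c + 1) = (f 0).2.toNat + closed (Fin.tail f) c := by
  rw [closed, cnt_fin_succ]
  cases (f 0).2 <;> simp [closed, Fin.tail] <;> rfl

@[simp] lemma opened_zero {n : ℕ} (f : Fin n → Bool × Bool) : opened f 0 = 0 := cnt_zero _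

@[simp] lemma closed_zero {n : ℕ} (f : Fin n → Bool × Bool) : closed f 0 = 0 := cnt_zero _

lemma isPath_cons (h : ℕ) : IsPath h f ↔
    (f 0).2.toNat ≤ h ∧ IsPath (h + (f 0).1.toNat - (f 0).2.toNat) (Fin.tail f) := by
  unfold IsPath
  rw [Fin.forall_fin_succ]
  simp only [Fin.val_zero, Fin.val_succ, opened_cons, closed_cons, opened_zero, closed_zero]
  constructor
  · rintro ⟨⟨h1, h2⟩, h3⟩
    exact ⟨by omega, fun i => by have := h2 i; omega, by omega⟩
  · rintro ⟨h1, h2, h3⟩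
    exact ⟨⟨by omega, fun i => by have := h2 i; omega⟩, by omega⟩

/-- A hexagon either starts at the first cutoff, a condition on the first two letters, or lies
in the rest of the path. -/
lemma hasHexagon_cons {h : ℕ} (hf : (f 0).2.toNat ≤ h) : HasHexagon h f ↔
    (∃ x, 2 ≤ x ∧ x + 1 ≤ h ∧ (f 0).2.toNat + closed (Fin.tail f) 1 + 1 ≤ x ∧
      x + 2 ≤ h + ((f 0).1.toNat + opened (Fin.tail f) 1)) ∨
    HasHexagon (h + (f 0).1.toNat - (f 0).2.toNat) (Fin.tail f) := by
  unfold HasHexagon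
  constructor
  · rintro ⟨_ | d, x, hx⟩
    · rw [show 0 + 2 = 1 + 1 from rfl, opened_cons, closed_cons, opened_zero, closed_zero] at hx
      exact .inl ⟨x, by omega⟩
    · rw [show d + 1 + 2 = d + 2 + 1 from rfl] at hx
      simp only [opened_cons, closed_cons] at hx
      exact .inr ⟨d, x - (f 0).2.toNat, by omega⟩
  · rintro (⟨x, hx⟩ | ⟨d, x, hx⟩)
    · refine ⟨0, x, ?_⟩
      rw [show 0 + 2 = 1 + 1 from rfl, opened_cons, closed_cons, opened_zero, closed_zero]
      omega
    · refine ⟨d + 1, x + (f 0).2.toNat, ?_⟩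
      rw [show d + 1 + 2 = d + 2 + 1 from rfl]
      simp only [opened_cons, closed_cons]
      omega

end cons

/-- The states of an automaton reading a path without hexagons: the current height, which never
exceeds `3`, together with what forbids a letter. From `dropped`, at height `2` just after a descent
from height `3`, the path may not rise. From `levelClosing` and `levelPlain`, at height `3` just
after a level step, only a level step of the same kind or a descent may follow. -/
inductive State
  | h0 | h1 | h2 | dropped | h3 | levelClosing | levelPlain

namespace State

/-- The height of the path in a given state. -/
def height : State → ℕ
  | h0 => 0
  | h1 => 1
  | h2 => 2
  | dropped => 2
  | h3 => 3
  | levelClosing => 3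
  | levelPlain => 3

/-- The transitions of the automaton; `none` stands for a forbidden letter. -/
def step : State → Bool × Bool → Option State
  | h0, (false, false) => some h0
  | h0, (true, false) => some h1
  | h1, (false, false) => some h1
  | h1, (true, true) => some h1
  | h1, (true, false) => some h2
  | h1, (false, true) => some h0
  | h2, (false, false) => some h2
  | h2, (true, true) => some h2
  | h2, (true, false) => some h3
  | h2, (false, true) => some h1
  | dropped, (false, false) => some h2
  | dropped, (true, true) => some h2
  | dropped, (false, true) => some h1
  | h3, (false, false) => some levelPlain
  | h3, (true, true) => some levelClosing
  | h3, (false, true) => some dropped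
  | levelPlain, (false, false) => some levelPlain
  | levelPlain, (false, true) => some dropped
  | levelClosing, (true, true) => some levelClosing
  | levelClosing, (false, true) => some dropped
  | _, _ => none

/-- The condition that a state puts on the next letter, in terms of the number `a` of openings
and `b` of closings in it. -/
def Allows : State → ℕ → ℕ → Prop
  | dropped, a, b => a ≤ b
  | levelClosing, _, b => b = 1
  | levelPlain, a, _ => a = 0
  | _, _, _ => True

/-- The automaton, started in a given state, reads the word and ends in the state `h0`. -/
def Accepts : State → (n : ℕ) → (Fin n → Bool × Bool) → Prop
  | q, 0, _ => q = h0
  | q, n + 1, f => ∃ q', step q (f 0) = some q' ∧ Accepts q' n (Fin.tail f)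

lemma accepts_iff (q : State) (n : ℕ) (f : Fin n → Bool × Bool) : q.Accepts n f ↔
    IsPath q.height f ∧ ¬ HasHexagon q.height f ∧ q.Allows (opened f 1) (closed f 1) := by
  induction n generalizing q with
  | zero =>
    have h1 : ∀ c, opened f c = 0 := fun c => by simp [opened, cnt]
    have h2 : ∀ c, closed f c = 0 := fun c => by simp [closed, cnt]
    cases q <;> simp [Accepts, IsPath, HasHexagon, Allows, height, h1, h2]
  | succ n ih =>
    rw [isPath_cons]
    have hx := cnt_add_le (fun i => (Fin.tail f i).1 = true) 0 1
    have hy := cnt_add_le (fun i => (Fin.tail f i).2 = true) 0 1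
    have e1 := opened_cons f 0
    have e2 := closed_cons f 0
    rw [zero_add, opened_zero, add_zero] at e1
    rw [zero_add, closed_zero, add_zero] at e2
    change opened (Fin.tail f) 1 ≤ opened (Fin.tail f) 0 + 1 at hx
    change closed (Fin.tail f) 1 ≤ closed (Fin.tail f) 0 + 1 at hy
    simp only [opened_zero, closed_zero] at hx hy
    rw [e1, e2]
    by_cases hle : (f 0).2.toNat ≤ q.height
    · rw [hasHexagon_cons f hle]
      simp only [Accepts, ih]
      have hex : ∀ h a b : ℕ, (∃ x, 2 ≤ x ∧ x + 1 ≤ h ∧ b + closed (Fin.tail f) 1 + 1 ≤ x ∧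
          x + 2 ≤ h + (a + opened (Fin.tail f) 1)) ↔ 3 ≤ h ∧ 4 ≤ h + a + opened (Fin.tail f) 1 ∧
          b + closed (Fin.tail f) 1 + 2 ≤ h ∧
          b + closed (Fin.tail f) 1 + 3 ≤ h + a + opened (Fin.tail f) 1 := fun h a b =>
        ⟨fun ⟨x, hx⟩ => by omega, fun hx => ⟨max 2 (b + closed (Fin.tail f) 1 + 1), by omega⟩⟩
      rw [hex]
      obtain hx | hx : opened (Fin.tail f) 1 = 0 ∨ opened (Fin.tail f) 1 = 1 := by omega
      all_goals obtain hy | hy : closed (Fin.tail f) 1 = 0 ∨ closed (Fin.tail f) 1 = 1 := by omega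
      all_goals
        simp only [hx, hy]
        rcases hf : f 0 with ⟨_ | _, _ | _⟩ <;> cases q <;> rw [hf] at hle <;>
          simp [step, height, Allows] at hle ⊢
    · simp only [hle, false_and, iff_false, Accepts]
      rcases hf : f 0 with ⟨_ | _, _ | _⟩ <;> cases q <;> rw [hf] at hle <;>
        simp [step, height] at hle ⊢

/-- The number of words of length `n` that the automaton accepts from a given state. -/
noncomputable def count (q : State) (n : ℕ) : ℕ := {f | q.Accepts n f}.ncard

lemma count_h0_zero : h0.count 0 = 1 := by simp [count, Accepts]

lemma count_zero {q : State} (h : q ≠ h0) : q.count 0 = 0 := by simp [count, Accepts, h]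

lemma count_succ (q : State) (n : ℕ) :
    q.count (n + 1) = ∑ s : Bool × Bool, ((q.step s).map fun q' => q'.count n).getD 0 := by
  have h : {f | q.Accepts (n + 1) f} = ⋃ s : Bool × Bool,
      (fun g : Fin n → Bool × Bool => (Fin.cons s g : Fin (n + 1) → Bool × Bool)) ''
        {g | ∃ q', q.step s = some q' ∧ q'.Accepts n g} := by
    ext f
    simp only [Set.mem_ofPred_eq, Set.mem_iUnion, Set.mem_image]
    constructor
    · exact fun h => ⟨f 0, Fin.tail f, h, Fin.cons_self_tail f⟩
    · rintro ⟨s, g, h, rfl⟩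
      simpa [Accepts] using h
  rw [count, h, Set.ncard_iUnion_of_finite (fun _ => Set.toFinite _), finsum_eq_sum_of_fintype]
  · refine Finset.sum_congr rfl fun s _ => ?_
    rw [Set.ncard_image_of_injective _ (Fin.cons_right_injective (α := fun _ => Bool × Bool) s)]
    cases q.step s <;> simp [count]
  · intro s s' hs
    rw [Function.onFun, Set.disjoint_left]
    rintro _ ⟨g, -, rfl⟩ ⟨g', -, h⟩
    exact hs (by simpa using (congrFun h 0).symm)

lemma count_succ_eq (n : ℕ) :
    h0.count (n + 1) = h0.count n + h1.count n ∧
    h1.count (n + 1) = 2 * h1.count n + h2.count n + h0.count n ∧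
    h2.count (n + 1) = 2 * h2.count n + h3.count n + h1.count n ∧
    dropped.count (n + 1) = 2 * h2.count n + h1.count n ∧
    h3.count (n + 1) = levelPlain.count n + levelClosing.count n + dropped.count n ∧
    levelPlain.count (n + 1) = levelPlain.count n + dropped.count n ∧
    levelClosing.count (n + 1) = levelClosing.count n + dropped.count n := by
  simp only [count_succ, Fintype.sum_prod_type, Fintype.sum_bool, step, Option.map_some,
    Option.map_none, Option.getD_some, Option.getD_none]
  omega

lemma count_levelPlain (n : ℕ) : levelPlain.count n = levelClosing.count n := by
  induction n with
  | zero => rw [count_zero (by simp), count_zero (by simp)]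
  | succ n ih => have := count_succ_eq n; omega

end State

lemma alpha_eq_count (n : ℕ) : alpha n = State.h0.count n := by
  rw [alpha_eq_ncard, State.count]
  simp [State.accepts_iff, State.Allows, State.height]

lemma alpha_recurrence (n : ℕ) :
    (alpha (n + 6) : ℤ) = 6 * alpha (n + 5) - 11 * alpha (n + 4) + 9 * alpha (n + 3)
      - 4 * alpha (n + 2) - 4 * alpha (n + 1) + alpha n := by
  simp only [alpha_eq_count]
  have h0 := State.count_succ_eq n
  have h1 := State.count_succ_eq (n + 1)
  have h2 := State.count_succ_eq (n + 2)
  have h3 := State.count_succ_eq (n + 3)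
  have h4 := State.count_succ_eq (n + 4)
  have h5 := State.count_succ_eq (n + 5)
  have h := State.count_levelPlain n
  simp only [add_assoc, Nat.reduceAdd] at h0 h1 h2 h3 h4 h5
  simp only [h5, h4, h3, h2, h1, h0, h]
  push_cast
  ring

lemma alpha_initial : alpha 0 = 1 ∧ alpha 1 = 1 ∧ alpha 2 = 2 ∧ alpha 3 = 5 ∧ alpha 4 = 14 ∧
    alpha 5 = 42 := by
  simp only [alpha_eq_count]
  have h0 := State.count_succ_eq 0
  have h1 := State.count_succ_eq 1
  have h2 := State.count_succ_eq 2
  have h3 := State.count_succ_eq 3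
  have h4 := State.count_succ_eq 4
  have e0 := State.count_h0_zero
  have e1 := State.count_zero (q := .h1) (by simp)
  have e2 := State.count_zero (q := .h2) (by simp)
  have e3 := State.count_zero (q := .h3) (by simp)
  have e4 := State.count_zero (q := .dropped) (by simp)
  have e5 := State.count_zero (q := .levelPlain) (by simp)
  have e6 := State.count_zero (q := .levelClosing) (by simp)
  simp only [zero_add, Nat.reduceAdd] at h0 h1 h2 h3 h4
  simp [h4, h3, h2, h1, h0, e0, e1, e2, e3, e4, e5, e6]

/-! ### The closed form -/

section closedForm
open Polynomial

/-- The numerator of the coefficient that belongs to a root of the characteristic polynomial, see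
`alpha_eq_sum`; its coefficients are those of the numerator of the generating function
of `alpha`, reversed. -/
def num {K : Type*} [CommRing K] (z : K) : K := z ^ 5 - 5 * z ^ 4 + 7 * z ^ 3 - 5 * z ^ 2 + z + 3

/-- The derivative of the characteristic polynomial. -/
def den {K : Type*} [CommRing K] (z : K) : K :=
  6 * z ^ 5 - 30 * z ^ 4 + 44 * z ^ 3 - 27 * z ^ 2 + 8 * z + 4

lemma map_num {K L : Type*} [CommRing K] [CommRing L] (φ : K →+* L) (z : K) :
    φ (num z) = num (φ z) := by
  simp only [num, map_add, map_sub, map_mul, map_pow, map_ofNat]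

lemma map_den {K L : Type*} [CommRing K] [CommRing L] (φ : K →+* L) (z : K) :
    φ (den z) = den (φ z) := by
  simp only [den, map_add, map_sub, map_mul, map_pow, map_ofNat]

lemma charPoly_eq : hexRecurrence.charPoly =
    (X ^ 6 - 6 * X ^ 5 + 11 * X ^ 4 - 9 * X ^ 3 + 4 * X ^ 2 + 4 * X - 1 : ℂ[X]) := by
  change monomial 6 1 - ∑ i : Fin 6, monomial i ((![1, -4, -4, 9, -11, 6] : Fin 6 → ℂ) i) = _
  simp [← C_mul_X_pow_eq_monomial, Fin.sum_univ_succ]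
  simp only [map_ofNat]
  ring

lemma eval_charPoly (z : ℂ) : hexRecurrence.charPoly.eval z =
    z ^ 6 - 6 * z ^ 5 + 11 * z ^ 4 - 9 * z ^ 3 + 4 * z ^ 2 + 4 * z - 1 := by
  simp [charPoly_eq]

lemma eval_derivative_charPoly (z : ℂ) : hexRecurrence.charPoly.derivative.eval z = den z := by
  simp [charPoly_eq, den]
  ring

lemma isSolution_alpha : hexRecurrence.IsSolution fun n => (alpha n : ℂ) := by
  intro n
  have h := congrArg (Int.cast : ℤ → ℂ) (alpha_recurrence n)
  push_cast at h
  change (alpha (n + 6) : ℂ) = ∑ i : Fin 6,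
    (![1, -4, -4, 9, -11, 6] : Fin 6 → ℂ) i * (alpha (n + i) : ℂ)
  simp [Fin.sum_univ_succ, h]
  ring

/-- The residues at the simple roots `z i` give the closed form: the power sums
`∑ i, z i ^ k / den (z i)` vanish for `k < 5` and equal `1` for `k = 5`, by Lagrange interpolation
of `X ^ k`, and `alpha` is the combination of six shifts of their sequence that `num` prescribes. -/
lemma alpha_eq_sum {z : Fin 6 → ℂ} (hz : Function.Injective z)
    (hprod : hexRecurrence.charPoly = ∏ i, (X - C (z i))) (n : ℕ) :
    (alpha n : ℂ) = ∑ i, num (z i) / den (z i) * z i ^ n := by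
  have hden : ∀ i, den (z i) = ∏ j ∈ Finset.univ.erase i, (z i - z j) := fun i => by
    rw [← eval_derivative_charPoly, hprod, ← Lagrange.nodal_eq,
      Lagrange.eval_nodal_derivative_eval_node_eq (Finset.mem_univ i), Lagrange.eval_nodal]
  have hroot : ∀ i, (z i) ^ 6 = 6 * z i ^ 5 - 11 * z i ^ 4 + 9 * z i ^ 3 - 4 * z i ^ 2
      - 4 * z i + 1 := fun i => by
    have h := eval_charPoly (z i)
    rw [hprod, ← Lagrange.nodal_eq, Lagrange.eval_nodal_at_node (Finset.mem_univ i)] at h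
    linear_combination -h
  set T : ℕ → ℂ := fun k => ∑ i, z i ^ k / den (z i) with hT
  have hlow : ∀ k < 6, T k = if k = 5 then 1 else 0 := fun k hk => by
    have h := Lagrange.coeff_eq_sum (s := Finset.univ) (v := z) hz.injOn (P := X ^ k)
      (by simpa using hk)
    simp only [Finset.card_univ, Fintype.card_fin, coeff_X_pow, eval_pow, eval_X, ← hden] at h
    rw [hT]
    simp only [← h]
    exact if_congr eq_comm rfl rfl
  have hrec : ∀ k, T (k + 6) = 6 * T (k + 5) - 11 * T (k + 4) + 9 * T (k + 3) - 4 * T (k + 2)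
      - 4 * T (k + 1) + T k := fun k => by
    simp only [hT, Finset.mul_sum, ← Finset.sum_sub_distrib, ← Finset.sum_add_distrib]
    refine Finset.sum_congr rfl fun i _ => ?_
    rw [pow_add, hroot i]
    ring
  have hsum : ∀ n, ∑ i, num (z i) / den (z i) * z i ^ n = T (n + 5) - 5 * T (n + 4)
      + 7 * T (n + 3) - 5 * T (n + 2) + T (n + 1) + 3 * T n := fun n => by
    simp only [hT, Finset.mul_sum, ← Finset.sum_sub_distrib, ← Finset.sum_add_distrib]
    refine Finset.sum_congr rfl fun i _ => ?_
    rw [num]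
    ring
  have t0 : T 0 = 0 := by simpa using hlow 0 (by norm_num)
  have t1 : T 1 = 0 := by simpa using hlow 1 (by norm_num)
  have t2 : T 2 = 0 := by simpa using hlow 2 (by norm_num)
  have t3 : T 3 = 0 := by simpa using hlow 3 (by norm_num)
  have t4 : T 4 = 0 := by simpa using hlow 4 (by norm_num)
  have t5 : T 5 = 1 := by simpa using hlow 5 (by norm_num)
  have t6 : T 6 = 6 := by rw [hrec 0]; norm_num [t0, t1, t2, t3, t4, t5]
  have t7 : T 7 = 25 := by rw [hrec 1]; norm_num [t1, t2, t3, t4, t5, t6]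
  have t8 : T 8 = 93 := by rw [hrec 2]; norm_num [t2, t3, t4, t5, t6, t7]
  have t9 : T 9 = 333 := by rw [hrec 3]; norm_num [t3, t4, t5, t6, t7, t8]
  have t10 : T 10 = 1172 := by rw [hrec 4]; norm_num [t4, t5, t6, t7, t8, t9]
  obtain ⟨a0, a1, a2, a3, a4, a5⟩ := alpha_initial
  rw [hsum]
  induction n using Nat.strong_induction_on with
  | _ n ih =>
    match n with
    | 0 => norm_num [a0, t0, t1, t2, t3, t4, t5]
    | 1 => norm_num [a1, t1, t2, t3, t4, t5, t6]
    | 2 => norm_num [a2, t2, t3, t4, t5, t6, t7]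
    | 3 => norm_num [a3, t3, t4, t5, t6, t7, t8]
    | 4 => norm_num [a4, t4, t5, t6, t7, t8, t9]
    | 5 => norm_num [a5, t5, t6, t7, t8, t9, t10]
    | n + 6 =>
      have h := congrArg (Int.cast : ℤ → ℂ) (alpha_recurrence n)
      push_cast at h
      rw [h, ih (n + 5) (by omega), ih (n + 4) (by omega), ih (n + 3) (by omega),
        ih (n + 2) (by omega), ih (n + 1) (by omega), ih n (by omega)]
      have r0 := hrec n
      have r1 := hrec (n + 1)
      have r2 := hrec (n + 2)
      have r3 := hrec (n + 3)
      have r4 := hrec (n + 4)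
      have r5 := hrec (n + 5)
      simp only [add_assoc, Nat.reduceAdd] at r0 r1 r2 r3 r4 r5 ⊢
      linear_combination -r5 + 5 * r4 - 7 * r3 + 5 * r2 - r1 - 3 * r0

end closedForm

/-! ### Approximations -/

section numerics
open Polynomial

/-- Products of approximations. -/
lemma near_mul {K : Type*} [NormedField K] {a b a₀ b₀ c₀ : K} {e₁ e₂ e : ℝ} (ha : ‖a - a₀‖ ≤ e₁)
    (hb : ‖b - b₀‖ ≤ e₂) (h : ‖a₀‖ * e₂ + (‖b₀‖ + e₂) * e₁ + ‖a₀ * b₀ - c₀‖ ≤ e) :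
    ‖a * b - c₀‖ ≤ e := by
  have hb' : ‖b‖ ≤ ‖b₀‖ + e₂ := by
    have := norm_add_le b₀ (b - b₀)
    rw [add_sub_cancel] at this
    linarith
  have e₁0 := (norm_nonneg _).trans ha
  calc ‖a * b - c₀‖ = ‖a₀ * (b - b₀) + b * (a - a₀) + (a₀ * b₀ - c₀)‖ := by congr 1; ring
    _ ≤ ‖a₀ * (b - b₀)‖ + ‖b * (a - a₀)‖ + ‖a₀ * b₀ - c₀‖ := norm_add₃_le
    _ ≤ ‖a₀‖ * e₂ + (‖b₀‖ + e₂) * e₁ + ‖a₀ * b₀ - c₀‖ := by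
      rw [norm_mul, norm_mul]
      gcongr
      exact (norm_nonneg _).trans hb'
    _ ≤ e := h

/-- Quotients of approximations. -/
lemma near_div {K : Type*} [NormedField K] {a b a₀ b₀ c₀ : K} {e₁ e₂ e : ℝ} (ha : ‖a - a₀‖ ≤ e₁)
    (hb : ‖b - b₀‖ ≤ e₂) (he₂ : e₂ < ‖b₀‖) (h : ‖a₀ - c₀ * b₀‖ + e₁ + ‖c₀‖ * e₂ ≤ e * (‖b₀‖ - e₂)) :
    ‖a / b - c₀‖ ≤ e := by
  have hb' : ‖b₀‖ - e₂ ≤ ‖b‖ := by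
    have := norm_sub_norm_le b₀ b
    rw [norm_sub_rev] at this
    linarith
  have hb0 : 0 < ‖b‖ := by linarith
  have e0 : 0 ≤ e := by
    by_contra! H
    have h1 := (norm_nonneg _).trans ha
    have h2 := (norm_nonneg _).trans hb
    have : e * (‖b₀‖ - e₂) < 0 := mul_neg_of_neg_of_pos H (by linarith)
    have : 0 ≤ ‖a₀ - c₀ * b₀‖ + e₁ + ‖c₀‖ * e₂ := by positivity
    linarith
  rw [div_sub' (norm_pos_iff.mp hb0), norm_div, div_le_iff₀ hb0]
  calc ‖a - b * c₀‖ = ‖(a₀ - c₀ * b₀) + (a - a₀) + c₀ * (b₀ - b)‖ := by congr 1; ring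
    _ ≤ ‖a₀ - c₀ * b₀‖ + ‖a - a₀‖ + ‖c₀ * (b₀ - b)‖ := norm_add₃_le
    _ ≤ ‖a₀ - c₀ * b₀‖ + e₁ + ‖c₀‖ * e₂ := by
      rw [norm_mul, norm_sub_rev b₀]
      gcongr
    _ ≤ e * ‖b‖ := h.trans (by gcongr)

lemma norm_pow_sub_pow_le {K : Type*} [NormedField K] {z w : K} (hz : ‖z‖ ≤ 4) (hw : ‖w‖ ≤ 4)
    (k : ℕ) : ‖z ^ (k + 1) - w ^ (k + 1)‖ ≤ (k + 1) * 4 ^ k * ‖z - w‖ := by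
  induction k with
  | zero => simp
  | succ k ih =>
    calc ‖z ^ (k + 1 + 1) - w ^ (k + 1 + 1)‖
        = ‖z * (z ^ (k + 1) - w ^ (k + 1)) + (z - w) * w ^ (k + 1)‖ := by congr 1; ring
      _ ≤ ‖z‖ * ‖z ^ (k + 1) - w ^ (k + 1)‖ + ‖z - w‖ * ‖w‖ ^ (k + 1) := by
        refine (norm_add_le _ _).trans ?_
        rw [norm_mul, norm_mul, norm_pow]
      _ ≤ 4 * ((k + 1) * 4 ^ k * ‖z - w‖) + ‖z - w‖ * 4 ^ (k + 1) := by gcongr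
      _ = (↑(k + 1) + 1) * 4 ^ (k + 1) * ‖z - w‖ := by push_cast; ring

/-- A Lipschitz bound for polynomials of degree at most `5` on the disc of radius `4`. -/
lemma norm_poly_sub_le {K : Type*} [RCLike K] {z w : K} (hz : ‖z‖ ≤ 4) (hw : ‖w‖ ≤ 4)
    (a : Fin 5 → K) : ‖∑ i, a i * (z ^ (i + 1 : ℕ) - w ^ (i + 1 : ℕ))‖ ≤
      (∑ i, ‖a i‖ * ((i + 1) * 4 ^ (i : ℕ))) * ‖z - w‖ := by
  rw [Finset.sum_mul]
  refine norm_sum_le_of_le _ fun i _ => ?_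
  rw [norm_mul, mul_assoc]
  gcongr
  exact norm_pow_sub_pow_le hz hw i

lemma norm_num_sub_le {K : Type*} [RCLike K] {z w : K} (hz : ‖z‖ ≤ 4) (hw : ‖w‖ ≤ 4) :
    ‖num z - num w‖ ≤ 20000 * ‖z - w‖ := by
  have h := norm_poly_sub_le hz hw ![1, -5, 7, -5, 1]
  have e : num z - num w = ∑ i : Fin 5, (![1, -5, 7, -5, 1] : Fin 5 → K) i *
      (z ^ (i + 1 : ℕ) - w ^ (i + 1 : ℕ)) := by
    simp [num, Fin.sum_univ_succ]
    ring
  rw [e]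
  refine h.trans (mul_le_mul_of_nonneg_right ?_ (norm_nonneg _))
  simp [Fin.sum_univ_succ]
  norm_num

lemma norm_den_sub_le {K : Type*} [RCLike K] {z w : K} (hz : ‖z‖ ≤ 4) (hw : ‖w‖ ≤ 4) :
    ‖den z - den w‖ ≤ 20000 * ‖z - w‖ := by
  have h := norm_poly_sub_le hz hw ![8, -27, 44, -30, 6]
  have e : den z - den w = ∑ i : Fin 5, (![8, -27, 44, -30, 6] : Fin 5 → K) i *
      (z ^ (i + 1 : ℕ) - w ^ (i + 1 : ℕ)) := by
    simp [den, Fin.sum_univ_succ]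
    ring
  rw [e]
  refine h.trans (mul_le_mul_of_nonneg_right ?_ (norm_nonneg _))
  simp [Fin.sum_univ_succ]
  norm_num

/-- An approximation of a root gives one of its coefficient: by the Lipschitz bounds, `num` and
`den` change by at most `2e-9`, which is small against `den w`. -/
lemma near_coeff {K : Type*} [RCLike K] {z w c₀ : K} (hz : ‖z - w‖ ≤ 1e-13) (hw : ‖w‖ ≤ 3.9)
    (hc : ‖c₀‖ ≤ 1) (hn : ‖num w - c₀ * den w‖ ≤ 1e-8) (hd : 4 ≤ ‖den w‖) :
    ‖num z / den z - c₀‖ ≤ 1e-8 := by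
  have hz4 : ‖z‖ ≤ 4 := by
    have := norm_add_le w (z - w)
    rw [add_sub_cancel] at this
    linarith
  have h1 := norm_num_sub_le hz4 (by linarith : ‖w‖ ≤ 4)
  have h2 := norm_den_sub_le hz4 (by linarith : ‖w‖ ≤ 4)
  refine near_div (a₀ := num w) (b₀ := den w) (e₁ := 2e-9) (e₂ := 2e-9)
    (by linarith) (by linarith) (by linarith) ?_
  linarith

lemma exists_real_root {l u : ℝ}
    (h : (l ^ 6 - 6 * l ^ 5 + 11 * l ^ 4 - 9 * l ^ 3 + 4 * l ^ 2 + 4 * l - 1) *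
      (u ^ 6 - 6 * u ^ 5 + 11 * u ^ 4 - 9 * u ^ 3 + 4 * u ^ 2 + 4 * u - 1) ≤ 0) (hlu : l ≤ u) :
    ∃ R, R ^ 6 - 6 * R ^ 5 + 11 * R ^ 4 - 9 * R ^ 3 + 4 * R ^ 2 + 4 * R - 1 = 0 ∧
      l ≤ R ∧ R ≤ u := by
  have hc : ContinuousOn (fun x : ℝ => x ^ 6 - 6 * x ^ 5 + 11 * x ^ 4 - 9 * x ^ 3 + 4 * x ^ 2
    + 4 * x - 1) (Set.uIcc l u) := by fun_prop
  have := intermediate_value_uIcc hc (Set.mem_uIcc.mpr (mul_nonpos_iff.mp h |>.symm.imp id And.symm))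
  obtain ⟨R, hR, h0⟩ := this
  rw [Set.uIcc_of_le hlu] at hR
  exact ⟨R, h0, hR⟩

/-- Approximations of the elementary symmetric functions of the two remaining roots, from the values
of the characteristic polynomial at `0` and at `1`. The decimals of the intermediate products are
roundings to `18` digits; the error bounds follow from `near_mul` and `near_div`. -/
lemma near_sum_prod {R₁ R₂ R₃ R₄ s t : ℝ} (h₁ : |R₁ - (-0.498904744545771644)| ≤ 1e-18)
    (h₂ : |R₂ - 0.219885185674999791| ≤ 1e-18) (h₃ : |R₃ - 1.956266446504974174| ≤ 1e-18)
    (h₄ : |R₄ - 3.435256524142198558| ≤ 1e-18) (ht : R₁ * R₂ * (R₃ * R₄) * t = -1)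
    (hs : (1 - R₁) * (1 - R₂) * ((1 - R₃) * (1 - R₄)) * (1 - s + t) = 4) :
    |s - 0.887496588223599120| ≤ 2e-14 ∧ |t - 1.356435714750439026| ≤ 1e-15 := by
  have k₁ : |(1 - R₁) - 1.498904744545771644| ≤ 1e-18 := by rw [abs_le] at *; constructor <;> linarith
  have k₂ : |(1 - R₂) - 0.780114814325000209| ≤ 1e-18 := by rw [abs_le] at *; constructor <;> linarith
  have k₃ : |(1 - R₃) - (-0.956266446504974174)| ≤ 1e-18 := by rw [abs_le] at *; constructor <;> linarith
  have k₄ : |(1 - R₄) - (-2.435256524142198558)| ≤ 1e-18 := by rw [abs_le] at *; constructor <;> linarith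
  simp only [← Real.norm_eq_abs] at *
  have p12 : ‖R₁ * R₂ - (-0.109701762388585337)‖ ≤ 1e-17 := near_mul h₁ h₂ (by norm_num [abs_le])
  have p34 : ‖R₃ * R₄ - 6.720277073316687797‖ ≤ 1e-17 := near_mul h₃ h₄ (by norm_num [abs_le])
  have p : ‖R₁ * R₂ * (R₃ * R₄) - (-0.737226238682444968)‖ ≤ 1e-16 := near_mul p12 p34 (by norm_num [abs_le])
  have q12 : ‖(1 - R₁) * (1 - R₂) - 1.169317796482186516‖ ≤ 1e-17 := near_mul k₁ k₂ (by norm_num)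
  have q34 : ‖(1 - R₃) * (1 - R₄) - 2.328754102669515065‖ ≤ 1e-17 := near_mul k₃ k₄ (by norm_num)
  have q : ‖(1 - R₁) * (1 - R₂) * ((1 - R₃) * (1 - R₄)) - 2.723053615882368900‖ ≤ 1e-16 :=
    near_mul q12 q34 (by norm_num)
  have hp0 := left_ne_zero_of_mul (ht.trans_ne (by norm_num))
  have hq0 := left_ne_zero_of_mul (hs.trans_ne (by norm_num))
  have t' : ‖-1 / (R₁ * R₂ * (R₃ * R₄)) - 1.356435714750439026‖ ≤ 1e-15 :=
    near_div (a₀ := -1) (e₁ := 0) (by norm_num) p (by norm_num) (by norm_num)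
  have u' : ‖4 / ((1 - R₁) * (1 - R₂) * ((1 - R₃) * (1 - R₄))) - 1.468939126526839906‖ ≤ 1e-15 :=
    near_div (a₀ := 4) (e₁ := 0) (by norm_num) q (by norm_num) (by norm_num)
  rw [← eq_div_of_mul_eq hp0 (by rw [mul_comm, ht])] at t'
  rw [← eq_div_of_mul_eq hq0 (by rw [mul_comm, hs])] at u'
  refine ⟨?_, t'⟩
  simp only [Real.norm_eq_abs, abs_le] at *
  constructor <;> linarith

/-- The two remaining roots are complex conjugate. -/
lemma exists_eq_conj {a b : ℂ} {s t : ℝ} (hs : a + b = s) (ht : a * b = t)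
    (hs' : |s - 0.887496588223599120| ≤ 2e-14) (ht' : |t - 1.356435714750439026| ≤ 1e-15) :
    b = conj a ∧ |a.re - 0.443748294111800| ≤ 5e-14 ∧ |(|a.im|) - 1.076811574149956| ≤ 5e-14 := by
  have s2 : ‖s * s - 0.787650194108528657‖ ≤ 5e-14 := near_mul (K := ℝ) hs' hs' (by norm_num)
  have e1 := congrArg Complex.re hs
  have e2 := congrArg Complex.im hs
  have e3 := congrArg Complex.re ht
  have e4 := congrArg Complex.im ht
  simp only [Complex.add_re, Complex.add_im, Complex.mul_re, Complex.mul_im, Complex.ofReal_re,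
    Complex.ofReal_im] at e1 e2 e3 e4
  have hb : b.im = -a.im := by linarith
  rw [hb] at e3 e4
  have h0 : a.im * (b.re - a.re) = 0 := by linarith
  rw [Real.norm_eq_abs] at s2
  rw [abs_le] at hs' ht' s2
  -- vanishing imaginary parts would make both roots real, but the discriminant `s ^ 2 - 4 * t` is
  -- negative
  have hre : b.re = a.re := by
    rcases mul_eq_zero.mp h0 with h | h
    · rw [h] at e3
      nlinarith [sq_nonneg (a.re - b.re)]
    · linarith
  have hconj : b = conj a := Complex.ext hre hb
  refine ⟨hconj, by rw [abs_le]; constructor <;> linarith, ?_⟩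
  have hv : |a.im| * |a.im| = t - s * s / 4 := by
    rw [abs_mul_abs_self]
    rw [hre] at e3
    have : a.re = s / 2 := by linarith
    rw [this] at e3
    linarith
  have := abs_nonneg a.im
  rw [abs_le]
  constructor <;> nlinarith

end numerics

/-! ### The roots of the characteristic polynomial -/

section roots
open Polynomial

lemma charPoly_eq_prod_roots : hexRecurrence.charPoly =
    (hexRecurrence.charPoly.roots.map fun a => X - C a).prod :=
  (IsAlgClosed.splits _).eq_prod_roots_of_monic hexRecurrence.charPoly_monic

lemma exists_roots_eq {R₁ R₂ R₃ R₄ : ℝ} (h₁₂ : R₁ < R₂) (h₂₃ : R₂ < R₃) (h₃₄ : R₃ < R₄)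
    (h : ∀ R ∈ ({R₁, R₂, R₃, R₄} : Multiset ℝ), hexRecurrence.charPoly.eval (R : ℂ) = 0) :
    ∃ a b : ℂ, hexRecurrence.charPoly.roots = {(R₁ : ℂ), (R₂ : ℂ), (R₃ : ℂ), (R₄ : ℂ), a, b} := by
  have hle : ({(R₁ : ℂ), (R₂ : ℂ), (R₃ : ℂ), (R₄ : ℂ)} : Multiset ℂ) ≤
      hexRecurrence.charPoly.roots := by
    rw [Multiset.le_iff_subset]
    · intro z hz
      rw [mem_roots hexRecurrence.charPoly_monic.ne_zero, IsRoot.def]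
      simp only [Multiset.insert_eq_cons, Multiset.mem_cons, Multiset.mem_singleton] at hz
      rcases hz with rfl | rfl | rfl | rfl <;> exact h _ (by simp)
    · simp [h₁₂.ne, h₂₃.ne, h₃₄.ne, (h₁₂.trans h₂₃).ne, (h₂₃.trans h₃₄).ne,
        (h₁₂.trans (h₂₃.trans h₃₄)).ne]
  obtain ⟨m, hm⟩ := Multiset.le_iff_exists_add.mp hle
  have hcard : hexRecurrence.charPoly.roots.card = 6 := by
    rw [← (IsAlgClosed.splits hexRecurrence.charPoly).natDegree_eq_card_roots]
    exact natDegree_eq_of_degree_eq_some hexRecurrence.charPoly_degree_eq_order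
  rw [hm, Multiset.card_add] at hcard
  simp only [Multiset.insert_eq_cons, Multiset.card_cons, Multiset.card_singleton] at hcard
  obtain ⟨a, b, rfl⟩ := Multiset.card_eq_two.mp (show m.card = 2 by omega)
  exact ⟨a, b, hm⟩

/-- The roots of the characteristic polynomial, with their approximations. -/
lemma exists_roots : ∃ (R₁ R₂ R₃ R₄ : ℝ) (z : ℂ),
    hexRecurrence.charPoly.roots = {(R₁ : ℂ), (R₂ : ℂ), (R₃ : ℂ), (R₄ : ℂ), z, conj z} ∧
    |R₁ - (-0.498904744545771644)| ≤ 1e-18 ∧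
    |R₂ - 0.219885185674999791| ≤ 1e-18 ∧
    |R₃ - 1.956266446504974174| ≤ 1e-18 ∧
    |R₄ - 3.435256524142198558| ≤ 1e-18 ∧
    ‖z - ⟨0.443748294111800, -1.076811574149956⟩‖ ≤ 1e-13 := by
  obtain ⟨R₁, e₁, l₁, u₁⟩ := exists_real_root (l := -0.498904744545771645)
    (u := -0.498904744545771643) (by norm_num) (by norm_num)
  obtain ⟨R₂, e₂, l₂, u₂⟩ := exists_real_root (l := 0.219885185674999790)
    (u := 0.219885185674999792) (by norm_num) (by norm_num)
  obtain ⟨R₃, e₃, l₃, u₃⟩ := exists_real_root (l := 1.956266446504974173)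
    (u := 1.956266446504974175) (by norm_num) (by norm_num)
  obtain ⟨R₄, e₄, l₄, u₄⟩ := exists_real_root (l := 3.435256524142198557)
    (u := 3.435256524142198559) (by norm_num) (by norm_num)
  have h₁ : |R₁ - (-0.498904744545771644)| ≤ 1e-18 := by rw [abs_le]; constructor <;> linarith
  have h₂ : |R₂ - 0.219885185674999791| ≤ 1e-18 := by rw [abs_le]; constructor <;> linarith
  have h₃ : |R₃ - 1.956266446504974174| ≤ 1e-18 := by rw [abs_le]; constructor <;> linarith
  have h₄ : |R₄ - 3.435256524142198558| ≤ 1e-18 := by rw [abs_le]; constructor <;> linarith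
  obtain ⟨a, b, hab⟩ := exists_roots_eq (R₁ := R₁) (R₂ := R₂) (R₃ := R₃) (R₄ := R₄) (by linarith)
    (by linarith) (by linarith) (fun R hR => by
      rw [eval_charPoly]
      simp only [Multiset.insert_eq_cons, Multiset.mem_cons, Multiset.mem_singleton] at hR
      rcases hR with rfl | rfl | rfl | rfl
      · exact_mod_cast e₁
      · exact_mod_cast e₂
      · exact_mod_cast e₃
      · exact_mod_cast e₄)
  have heval : ∀ x : ℂ, x ^ 6 - 6 * x ^ 5 + 11 * x ^ 4 - 9 * x ^ 3 + 4 * x ^ 2 + 4 * x - 1 =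
      (x - R₁) * ((x - R₂) * ((x - R₃) * ((x - R₄) * ((x - a) * (x - b))))) := fun x => by
    rw [← eval_charPoly, charPoly_eq_prod_roots, hab]
    simp
  have v₀ := heval 0
  have v₁ := heval 1
  -- the product and the sum of `a` and `b` are real, being determined by the real roots
  have hp : ((R₁ * R₂ * (R₃ * R₄) : ℝ) : ℂ) * (a * b) = -1 := by
    push_cast
    linear_combination -v₀
  have hq : (((1 - R₁) * (1 - R₂) * ((1 - R₃) * (1 - R₄)) : ℝ) : ℂ) * (1 - (a + b) + a * b) = 4 := by
    push_cast
    linear_combination -v₁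
  set P := R₁ * R₂ * (R₃ * R₄) with hP
  set Q := (1 - R₁) * (1 - R₂) * ((1 - R₃) * (1 - R₄)) with hQ
  have hP0 : (P : ℂ) ≠ 0 := left_ne_zero_of_mul (hp.trans_ne (by norm_num))
  have hQ0 : (Q : ℂ) ≠ 0 := left_ne_zero_of_mul (hq.trans_ne (by norm_num))
  have hP0' : P ≠ 0 := by exact_mod_cast hP0
  have hQ0' : Q ≠ 0 := by exact_mod_cast hQ0
  have hprod : a * b = ((-1 / P : ℝ) : ℂ) := by
    push_cast
    rw [eq_div_iff hP0, mul_comm, hp]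
  have hsum : a + b = ((1 + -1 / P - 4 / Q : ℝ) : ℂ) := by
    have : 1 - (a + b) + a * b = 4 / Q := by rw [eq_div_iff hQ0, mul_comm, hq]
    push_cast at hprod ⊢
    linear_combination hprod - this
  obtain ⟨hs, ht⟩ := near_sum_prod (s := 1 + -1 / P - 4 / Q) (t := -1 / P) h₁ h₂ h₃ h₄
    (by rw [← hP]; field_simp) (by rw [← hQ]; field_simp; ring)
  have hbound : ∀ z : ℂ, |z.re - 0.443748294111800| ≤ 5e-14 → z.im ≤ 0 →
      |(|z.im|) - 1.076811574149956| ≤ 5e-14 → ‖z - ⟨0.443748294111800, -1.076811574149956⟩‖ ≤ 1e-13 := by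
    intro z hre h0 him
    refine (Complex.norm_le_abs_re_add_abs_im _).trans ?_
    rw [abs_of_nonpos h0, ← abs_neg] at him
    rw [Complex.sub_re, Complex.sub_im]
    have : |z.im - -1.076811574149956| ≤ 5e-14 := by convert him using 2; ring
    linarith
  rcases le_total a.im 0 with h0 | h0
  · obtain ⟨rfl, hre, him⟩ := exists_eq_conj hsum hprod hs ht
    exact ⟨R₁, R₂, R₃, R₄, a, hab, h₁, h₂, h₃, h₄, hbound a hre h0 him⟩
  · obtain ⟨rfl, hre, him⟩ := exists_eq_conj hsum hprod hs ht
    refine ⟨R₁, R₂, R₃, R₄, conj a, ?_, h₁, h₂, h₃, h₄, hbound _ (by simpa using hre)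
      (by simpa using h0) (by simpa using him)⟩
    rw [hab, Complex.conj_conj]
    simp only [Multiset.insert_eq_cons]
    rw [← Multiset.cons_zero a, ← Multiset.cons_zero (conj a), Multiset.cons_swap a]

lemma num_mk (x y : ℝ) : num (⟨x, y⟩ : ℂ) =
    ⟨x ^ 5 - 10 * x ^ 3 * y ^ 2 + 5 * x * y ^ 4 - 5 * (x ^ 4 - 6 * x ^ 2 * y ^ 2 + y ^ 4)
        + 7 * (x ^ 3 - 3 * x * y ^ 2) - 5 * (x ^ 2 - y ^ 2) + x + 3,
      5 * x ^ 4 * y - 10 * x ^ 2 * y ^ 3 + y ^ 5 - 5 * (4 * x ^ 3 * y - 4 * x * y ^ 3)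
        + 7 * (3 * x ^ 2 * y - y ^ 3) - 10 * x * y + y⟩ := by
  apply Complex.ext <;> simp [num, pow_succ] <;> ring

lemma den_mk (x y : ℝ) : den (⟨x, y⟩ : ℂ) =
    ⟨6 * (x ^ 5 - 10 * x ^ 3 * y ^ 2 + 5 * x * y ^ 4)
        - 30 * (x ^ 4 - 6 * x ^ 2 * y ^ 2 + y ^ 4) + 44 * (x ^ 3 - 3 * x * y ^ 2)
        - 27 * (x ^ 2 - y ^ 2) + 8 * x + 4,
      6 * (5 * x ^ 4 * y - 10 * x ^ 2 * y ^ 3 + y ^ 5) - 30 * (4 * x ^ 3 * y - 4 * x * y ^ 3)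
        + 44 * (3 * x ^ 2 * y - y ^ 3) - 54 * x * y + 8 * y⟩ := by
  apply Complex.ext <;> simp [den, pow_succ] <;> ring

lemma near_coeff₅ {z : ℂ} (hz : ‖z - ⟨0.443748294111800, -1.076811574149956⟩‖ ≤ 1e-13) :
    ‖num z / den z - ⟨0.007144872966, 0.019135608521⟩‖ ≤ 1e-8 := by
  refine near_coeff hz ?_ ?_ ?_ ?_
  · refine (Complex.norm_le_abs_re_add_abs_im _).trans ?_
    norm_num
  · refine (Complex.norm_le_abs_re_add_abs_im _).trans ?_
    norm_num
  · refine (Complex.norm_le_abs_re_add_abs_im _).trans ?_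
    rw [num_mk, den_mk]
    simp only [Complex.sub_re, Complex.sub_im, Complex.mul_re, Complex.mul_im]
    norm_num [abs_le]
  · refine le_trans ?_ (Complex.abs_re_le_norm _)
    rw [den_mk]
    norm_num

end roots

/-! ### Asymptotic growth and decimals -/

lemma alpha_isEquivalent {R₁ R₂ R₃ R₄ c₁ c₂ c₃ c₄ : ℝ} {R₅ c₅ : ℂ}
    (h : ∀ n : ℕ, (alpha n : ℂ) =
      c₁ * (R₁ : ℂ) ^ n + c₂ * (R₂ : ℂ) ^ n + c₃ * (R₃ : ℂ) ^ n + c₄ * (R₄ : ℂ) ^ n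
        + c₅ * R₅ ^ n + conj (c₅ * R₅ ^ n))
    (h₁ : |R₁| < |R₄|) (h₂ : |R₂| < |R₄|) (h₃ : |R₃| < |R₄|) (h₅ : ‖R₅‖ < |R₄|) (hc : c₄ ≠ 0) :
    Asymptotics.IsEquivalent Filter.atTop (fun n : ℕ => (alpha n : ℝ)) (fun n : ℕ => c₄ * R₄ ^ n) := by
  have hre : ∀ n : ℕ, (alpha n : ℝ) - c₄ * R₄ ^ n =
      c₁ * R₁ ^ n + c₂ * R₂ ^ n + c₃ * R₃ ^ n + 2 * (c₅ * R₅ ^ n).re := fun n => by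
    have h' := congrArg Complex.re (h n)
    rw [Complex.add_re, Complex.conj_re] at h'
    simp only [← Complex.ofReal_pow, ← Complex.ofReal_mul, Complex.add_re, Complex.ofReal_re,
      Complex.natCast_re] at h'
    linarith
  have h5 : (fun n : ℕ => 2 * (c₅ * R₅ ^ n).re) =o[Filter.atTop] fun n => R₄ ^ n := by
    refine Asymptotics.IsBigO.trans_isLittleO
      (Asymptotics.IsBigO.of_bound (2 * ‖c₅‖) (.of_forall fun n => ?_))
      (isLittleO_pow_pow_of_abs_lt_left (r₁ := ‖R₅‖) (by rwa [abs_norm]))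
    have := Complex.abs_re_le_norm (c₅ * R₅ ^ n)
    rw [norm_mul, norm_pow] at this
    rw [norm_mul, Real.norm_ofNat, Real.norm_eq_abs, norm_pow, norm_norm]
    linarith
  rw [Asymptotics.IsEquivalent]
  refine Asymptotics.IsLittleO.const_mul_right hc ?_
  refine ((((isLittleO_pow_pow_of_abs_lt_left h₁).const_mul_left c₁).add
    ((isLittleO_pow_pow_of_abs_lt_left h₂).const_mul_left c₂)).add
    ((isLittleO_pow_pow_of_abs_lt_left h₃).const_mul_left c₃)).add h5 |>.congr_left fun n => ?_
  exact (hre n).symm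

/-- An approximation with error `1e-7` decides the rounding, as no value in question is closer than
`1e-7` to the boundary `5e-6`. -/
lemma roundsTo_of_near {x x₀ d : ℝ} (h : |x - x₀| ≤ 1e-7) (hd : |x₀ - d| < 0.0000049) :
    RoundsTo x d :=
  (abs_sub_le x x₀ d).trans_lt (by linarith)

lemma roundsTo_re_of_near {z : ℂ} {x y d : ℝ} (h : ‖z - ⟨x, y⟩‖ ≤ 1e-7)
    (hd : |x - d| < 0.0000049) : RoundsTo z.re d :=
  roundsTo_of_near ((Complex.abs_re_le_norm (z - ⟨x, y⟩)).trans h) hd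

lemma roundsTo_im_of_near {z : ℂ} {x y d : ℝ} (h : ‖z - ⟨x, y⟩‖ ≤ 1e-7)
    (hd : |y - d| < 0.0000049) : RoundsTo z.im d :=
  roundsTo_of_near ((Complex.abs_im_le_norm (z - ⟨x, y⟩)).trans h) hd

/-- The closed form in terms of the real roots and the pair of conjugate roots. -/
lemma alpha_eq_of_roots {R₁ R₂ R₃ R₄ : ℝ} {z : ℂ} (h₁₂ : R₁ < R₂) (h₂₃ : R₂ < R₃) (h₃₄ : R₃ < R₄)
    (hz : z.im ≠ 0) (hroots : hexRecurrence.charPoly.roots =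
      {(R₁ : ℂ), (R₂ : ℂ), (R₃ : ℂ), (R₄ : ℂ), z, conj z}) (n : ℕ) :
    (alpha n : ℂ) =
      (num R₁ / den R₁ : ℝ) * (R₁ : ℂ) ^ n + (num R₂ / den R₂ : ℝ) * (R₂ : ℂ) ^ n
      + (num R₃ / den R₃ : ℝ) * (R₃ : ℂ) ^ n + (num R₄ / den R₄ : ℝ) * (R₄ : ℂ) ^ n
      + num z / den z * z ^ n + conj (num z / den z * z ^ n) := by
  have hreal : ∀ R : ℝ, (R : ℂ) ≠ z := fun R h => hz (by rw [← h, Complex.ofReal_im])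
  have hreal' : ∀ R : ℝ, (R : ℂ) ≠ conj z := fun R h =>
    hreal R (by rw [← Complex.conj_conj z, ← h, Complex.conj_ofReal])
  have hself : z ≠ conj z := fun h => hz (Complex.conj_eq_iff_im.mp h.symm)
  have hinj : Function.Injective ![(R₁ : ℂ), R₂, R₃, R₄, z, conj z] := by
    rw [← List.nodup_ofFn]
    simp [hreal, hreal', hself, h₁₂.ne, h₂₃.ne, h₃₄.ne, (h₁₂.trans h₂₃).ne, (h₂₃.trans h₃₄).ne,
      (h₁₂.trans (h₂₃.trans h₃₄)).ne]
  have hnum : ∀ R : ℝ, ((num R : ℝ) : ℂ) = num (R : ℂ) := map_num Complex.ofRealHom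
  have hden : ∀ R : ℝ, ((den R : ℝ) : ℂ) = den (R : ℂ) := map_den Complex.ofRealHom
  rw [alpha_eq_sum hinj]
  · simp [Fin.sum_univ_succ, hnum, hden, map_num, map_den]
    ring
  · rw [charPoly_eq_prod_roots, hroots]
    simp [Fin.prod_univ_succ]

end Hex321

theorem mainTheorem2 :
    ∃ (R₁ R₂ R₃ R₄ : ℝ) (R₅ : ℂ) (c₁ c₂ c₃ c₄ : ℝ) (c₅ : ℂ),
      -- the recurrence, and the six roots (with multiplicity) of its characteristic polynomial
      Hex321.hexRecurrence.IsSolution (fun n => (Hex321.alpha n : ℂ)) ∧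
      Hex321.hexRecurrence.charPoly.roots =
        {(R₁ : ℂ), (R₂ : ℂ), (R₃ : ℂ), (R₄ : ℂ), R₅, conj R₅} ∧
      -- the closed form
      (∀ n : ℕ, (Hex321.alpha n : ℂ) =
        c₁ * (R₁ : ℂ) ^ n + c₂ * (R₂ : ℂ) ^ n + c₃ * (R₃ : ℂ) ^ n + c₄ * (R₄ : ℂ) ^ n
          + c₅ * R₅ ^ n + conj (c₅ * R₅ ^ n)) ∧
      -- the roots
      Hex321.RoundsTo R₁ (-0.49890) ∧
      Hex321.RoundsTo R₂ 0.21989 ∧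
      Hex321.RoundsTo R₃ 1.95627 ∧
      Hex321.RoundsTo R₄ 3.43526 ∧
      Hex321.RoundsTo R₅.re 0.44375 ∧ Hex321.RoundsTo R₅.im (-1.07681) ∧
      -- the coefficients
      Hex321.RoundsTo c₁ (-0.00328) ∧
      Hex321.RoundsTo c₂ 0.62652 ∧
      Hex321.RoundsTo c₃ 0.29217 ∧
      Hex321.RoundsTo c₄ 0.07030 ∧
      Hex321.RoundsTo c₅.re 0.00714 ∧ Hex321.RoundsTo c₅.im 0.01914 ∧
      -- the coefficients of the same closed form written with the powers `R ^ (n - 1)`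
      Hex321.RoundsTo (c₁ * R₁) 0.00164 ∧
      Hex321.RoundsTo (c₂ * R₂) 0.13776 ∧
      Hex321.RoundsTo (c₃ * R₃) 0.57156 ∧
      Hex321.RoundsTo (c₄ * R₄) 0.24149 ∧
      Hex321.RoundsTo (c₅ * R₅).re 0.02378 ∧ Hex321.RoundsTo (c₅ * R₅).im 0.00080 ∧
      -- the growth rate
      Asymptotics.IsEquivalent Filter.atTop
        (fun n : ℕ => (Hex321.alpha n : ℝ)) (fun n : ℕ => c₄ * R₄ ^ n) := by
  obtain ⟨R₁, R₂, R₃, R₄, z, hroots, h₁, h₂, h₃, h₄, h₅⟩ := Hex321.exists_roots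
  have c₁ : ‖Hex321.num R₁ / Hex321.den R₁ - (-0.003278755369)‖ ≤ 1e-8 := by
    refine Hex321.near_coeff (w := (-0.498904744545771644)) ?_ ?_ ?_ ?_ ?_
    · rw [Real.norm_eq_abs]; linarith
    all_goals norm_num [Hex321.num, Hex321.den, abs_le]
  have c₂ : ‖Hex321.num R₂ / Hex321.den R₂ - 0.626523685516‖ ≤ 1e-8 := by
    refine Hex321.near_coeff (w := 0.219885185674999791) ?_ ?_ ?_ ?_ ?_
    · rw [Real.norm_eq_abs]; linarith
    all_goals norm_num [Hex321.num, Hex321.den, abs_le]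
  have c₃ : ‖Hex321.num R₃ / Hex321.den R₃ - 0.292167188060‖ ≤ 1e-8 := by
    refine Hex321.near_coeff (w := 1.956266446504974174) ?_ ?_ ?_ ?_ ?_
    · rw [Real.norm_eq_abs]; linarith
    all_goals norm_num [Hex321.num, Hex321.den, abs_le]
  have c₄ : ‖Hex321.num R₄ / Hex321.den R₄ - 0.070298135861‖ ≤ 1e-8 := by
    refine Hex321.near_coeff (w := 3.435256524142198558) ?_ ?_ ?_ ?_ ?_
    · rw [Real.norm_eq_abs]; linarith
    all_goals norm_num [Hex321.num, Hex321.den, abs_le]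
  have c₅ := Hex321.near_coeff₅ h₅
  have p₁ : ‖Hex321.num R₁ / Hex321.den R₁ * R₁ - 0.0016357866‖ ≤ 1e-7 :=
    Hex321.near_mul c₁ h₁ (by norm_num [abs_le])
  have p₂ : ‖Hex321.num R₂ / Hex321.den R₂ * R₂ - 0.1377632769‖ ≤ 1e-7 :=
    Hex321.near_mul c₂ h₂ (by norm_num [abs_le])
  have p₃ : ‖Hex321.num R₃ / Hex321.den R₃ * R₃ - 0.5715568668‖ ≤ 1e-7 :=
    Hex321.near_mul c₃ h₃ (by norm_num [abs_le])
  have p₄ : ‖Hex321.num R₄ / Hex321.den R₄ * R₄ - 0.2414921299‖ ≤ 1e-7 :=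
    Hex321.near_mul c₄ h₄ (by norm_num [abs_le])
  have p₅ : ‖Hex321.num z / Hex321.den z * z - ⟨0.0237759699, 0.0007977117⟩‖ ≤ 1e-7 := by
    have k₁ : ‖(⟨0.007144872966, 0.019135608521⟩ : ℂ)‖ ≤ 1 :=
      (Complex.norm_le_abs_re_add_abs_im _).trans (by norm_num)
    have k₂ : ‖(⟨0.443748294111800, -1.076811574149956⟩ : ℂ)‖ ≤ 2 :=
      (Complex.norm_le_abs_re_add_abs_im _).trans (by norm_num)
    have k₃ : ‖(⟨0.007144872966, 0.019135608521⟩ * ⟨0.443748294111800, -1.076811574149956⟩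
        - ⟨0.0237759699, 0.0007977117⟩ : ℂ)‖ ≤ 1e-9 := by
      refine (Complex.norm_le_abs_re_add_abs_im _).trans ?_
      rw [Complex.sub_re, Complex.sub_im, Complex.mul_re, Complex.mul_im]
      norm_num [abs_le]
    refine Hex321.near_mul c₅ h₅ ?_
    linarith
  have hz : ‖z - ⟨0.443748294111800, -1.076811574149956⟩‖ ≤ 1e-7 := h₅.trans (by norm_num)
  have hzim := (Complex.abs_im_le_norm _).trans h₅
  have hznorm : ‖z‖ < 3 := by
    have k₂ : ‖(⟨0.443748294111800, -1.076811574149956⟩ : ℂ)‖ ≤ 2 :=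
      (Complex.norm_le_abs_re_add_abs_im _).trans (by norm_num)
    have := norm_le_norm_add_norm_sub' z ⟨0.443748294111800, -1.076811574149956⟩
    linarith
  have l₁ := abs_le.mp h₁
  have l₂ := abs_le.mp h₂
  have l₃ := abs_le.mp h₃
  have l₄ := abs_le.mp h₄
  have lc₄ := abs_le.mp c₄
  have lz := abs_le.mp hzim
  rw [Complex.sub_im] at lz
  have hclosed := Hex321.alpha_eq_of_roots (by linarith) (by linarith) (by linarith)
    (by dsimp only at lz; exact ne_of_lt (by linarith)) hroots
  refine ⟨R₁, R₂, R₃, R₄, z, _, _, _, _, _, Hex321.isSolution_alpha, hroots, hclosed,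
    Hex321.roundsTo_of_near (h₁.trans (by norm_num)) (by norm_num [abs_lt]),
    Hex321.roundsTo_of_near (h₂.trans (by norm_num)) (by norm_num [abs_lt]),
    Hex321.roundsTo_of_near (h₃.trans (by norm_num)) (by norm_num [abs_lt]),
    Hex321.roundsTo_of_near (h₄.trans (by norm_num)) (by norm_num [abs_lt]),
    Hex321.roundsTo_re_of_near hz (by norm_num [abs_lt]),
    Hex321.roundsTo_im_of_near hz (by norm_num [abs_lt]),
    Hex321.roundsTo_of_near (c₁.trans (by norm_num)) (by norm_num [abs_lt]),
    Hex321.roundsTo_of_near (c₂.trans (by norm_num)) (by norm_num [abs_lt]),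
    Hex321.roundsTo_of_near (c₃.trans (by norm_num)) (by norm_num [abs_lt]),
    Hex321.roundsTo_of_near (c₄.trans (by norm_num)) (by norm_num [abs_lt]),
    Hex321.roundsTo_re_of_near (c₅.trans (by norm_num)) (by norm_num [abs_lt]),
    Hex321.roundsTo_im_of_near (c₅.trans (by norm_num)) (by norm_num [abs_lt]),
    Hex321.roundsTo_of_near p₁ (by norm_num [abs_lt]),
    Hex321.roundsTo_of_near p₂ (by norm_num [abs_lt]),
    Hex321.roundsTo_of_near p₃ (by norm_num [abs_lt]),
    Hex321.roundsTo_of_near p₄ (by norm_num [abs_lt]),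
    Hex321.roundsTo_re_of_near p₅ (by norm_num [abs_lt]),
    Hex321.roundsTo_im_of_near p₅ (by norm_num [abs_lt]),
    Hex321.alpha_isEquivalent hclosed ?_ ?_ ?_ ?_ ?_⟩
  · rw [abs_of_pos (by linarith : 0 < R₄), abs_lt]
    constructor <;> linarith
  · rw [abs_of_pos (by linarith : 0 < R₄), abs_lt]
    constructor <;> linarith
  · rw [abs_of_pos (by linarith : 0 < R₄), abs_lt]
    constructor <;> linarith
  · rw [abs_of_pos (by linarith : 0 < R₄)]
    linarith
  · exact ne_of_gt (by linarith)
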